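/- **Notation.** $\|\cdot\|$ is the maximum norm of vectors and the induced matrix norm (largest absolute row sum); $\|v\|_{\mathcal L_\infty}$ and $\|v_\tau\|_{\mathcal L_\infty}$ are the $\mathcal L_\infty$ norms of $\|v(t)\|$ over $[0,\infty)$ and $[0,\tau]$. A transfer matrix is a matrix of real rational functions of $s$; it is stable if all its poles lie in the open left half-plane. For a stable proper transfer matrix $F(s)$ with impulse response $F_0\delta(t)+h(t)$, $\|F(s)\|_{\mathcal L_1}=\max_i\sum_j\big(|(F_0)_{ij}|+\int_0^\infty|h_{ij}(t)|\,dt\big)$. $N^\dagger=(N^\top N)^{-1}N^\top$ for $N$ of full column rank. **Plant.** Let $m\le p$; let $A_m\in\mathbb R^{n\times n}$ be Hurwitz, $B_m\in\mathbb R^{n\times m}$, $C_m\in\mathbb R^{p\times n}$, let $(A_m,B_m,C_m)$ be a minimal realization of $M(s)=C_m(s\mathbb I-A_m)^{-1}B_m$, and let $M(s)$ have full normal column rank $m$ and no transmission zeros in the closed right half-plane. Let $\mathcal C_\omega=[\omega_l,\omega_u]$ with $0<\omega_l<\omega_u$. Let $f:\mathbb R^n\times[0,\infty)\to\mathbb R^m$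 and $b_0>0$ satisfy $\|f(0,t)\|<b_0$ for $t\ge0$, and suppose that for every $\delta>0$ there are given $d_\delta,b_\delta>0$ such that $f$ is differentiable in $x$ and in $t$ with $\|\partial f/\partial x\|\le d_\delta$, $\|\partial f/\partial t\|\le b_\delta$ for all $\|x\|<\delta$, $t\ge0$. **Design.** Let $\rho_0,\bar\gamma,\alpha>0$, and $L_\delta=\frac{\delta+\bar\gamma}{\delta}\,d_{\delta+\bar\gamma}$ for $\delta>0$. Let $Z(s)=C_z(s\mathbb I-A_z)^{-1}B_z+D_z$ be an $m\times m$ transfer matrix, given by a minimal realization with $A_z\in\mathbb R^{n_z\times n_z}$ Hurwitz and $\det\begin{bmatrix}-s\mathbb I+A_z&B_z\\C_z&D_z\end{bmatrix}\ne0$ for all $s\in\mathbb C$, such that $Z^{-1}(s)$ is a right interactor of $sM(s)$, i.e. $\lim_{s\to\infty}sM(s)Z^{-1}(s)$ exists and has full rank. Let $T_z\in\mathbb R^{n\times n_z}$, of full column rank, and $\bar B\in\mathbb R^{n\times m}$ satisfy $$A_mT_z=T_zA_z+\bar BC_z,\quad C_mA_mT_z=C_m\bar BC_z,\quad B_m=T_zB_z+\bar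 BD_z,\quad C_mB_m=C_m\bar BD_z .$$ Let $H=\bar B(C_m\bar B)^\dagger$, and let $K_v$ be such that $A_v=(\mathbb I-HC_m)A_m+K_vC_m$ is Hurwitz. Let $P_y$, $Q$ and $P_v$ be positive definite with $A_v^\top P_v+P_vA_v=-Q$ and $0<\epsilon_q<\lambda_{\min}(Q)$. Put $\bar P_v=(\mathbb I-HC_m)^\top P_v(\mathbb I-HC_m)$ and $$\kappa_m=\sup_{t\ge0}\|e^{A_mt}\|,\qquad \kappa_y=\sqrt{n\,\tfrac{\lambda_{\max}(\bar P_v)}{\lambda_{\min}(P_y)}},\qquad \kappa_v=\sqrt{n\,\tfrac{\lambda_{\max}(\bar P_v)}{\lambda_{\min}(P_v)}} .$$ Let $r\in\mathcal L_\infty([0,\infty);\mathbb R^{m_r})$ and $K_g\in\mathbb R^{m\times m_r}$. Let $D(s)$ be an $m\times m$ transfer matrix such that, for all $\omega\in\mathcal C_\omega$, $\mathbb I+\omega D(s)$ is invertible and, with $C_0(s)=D(s)(\mathbb I+\omega D(s))^{-1}$ and $C(s)=\omega C_0(s)$, the matrix $C(s)$ is stable, $C(0)=\mathbb I$, and $C(s)Z^{-1}(s)$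 is strictly proper. Put $$H_0=(s\mathbb I-A_m)^{-1}B_m,\quad H_r=H_0CK_g,\quad G=H_0(\mathbb I-C),\quad H_1=\omega H_0C_1,\quad H_2=\omega H_0C_2,$$ $$C_1=(s+\alpha)C_0Z^{-1}(C_m\bar B)^\dagger,\qquad C_2=C_0Z^{-1}(C_m\bar B)^\dagger C_mA_m,$$ $$\rho_{ext}=\|H_r\|_{\mathcal L_1}\|r\|_{\mathcal L_\infty}+\|G\|_{\mathcal L_1}b_0,\quad \rho_{int}=(\kappa_m+\kappa_x)\rho_0,\quad \kappa_x=\|H_1\|_{\mathcal L_1}\kappa_y+\|H_2\|_{\mathcal L_1}\kappa_v .$$ Suppose that $\rho_r>0$ satisfies, for all $\omega\in\mathcal C_\omega$, $$\|G(s)\|_{\mathcal L_1}<\frac{\rho_r-\rho_{ext}-\rho_{int}}{L_{\rho_r}\,\rho_r}.$$ **Reference system.** For $\omega\in\mathcal C_\omega$ consider $$\dot x_{ref}(t)=A_mx_{ref}(t)+B_m\big(\omega u_{ref}(t)+f(x_{ref}(t),t)\big),\quad x_{ref}(0)=0,\qquad u_{ref}(s)=C_0(s)\big(K_gr(s)-\eta_{ref}(s)\big),$$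 where $\eta_{ref}(s)$ is the Laplace transform of $f(x_{ref}(t),t)$; that is, $u_{ref}$ is the zero-state response of $C_0(s)$ to $K_gr-f(x_{ref},\cdot)$. **Lemma 4.** For each $\omega\in\mathcal C_\omega$, $$\rho_{rx}=\rho_r-\frac{\rho_{int}}{1-\|G(s)\|_{\mathcal L_1}L_{\rho_r}}>0,$$ and for each $\tau>0$ every solution $(x_{ref},u_{ref})$ of the reference system on $[0,\tau]$ satisfies $$\|x_{ref,\tau}\|_{\mathcal L_\infty}\le\rho_{rx},\qquad \|u_{ref,\tau}\|_{\mathcal L_\infty}\le\rho_{ru},$$ where $\rho_{ru}=\|C_0(s)\|_{\mathcal L_1}(L_{\rho_r}\rho_{rx}+b_0)+\|C_0(s)K_g\|_{\mathcal L_1}\|r\|_{\mathcal L_\infty}$. -/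

import Mathlib

open MeasureTheory Filter Topology Matrix

open scoped ENNReal

noncomputable section

namespace L1Adaptive

/-! ### Matrices and signals

Vectors are functions `Fin k → ℝ`, whose Mathlib norm is the maximum norm. -/

/-- The matrix norm induced by the maximum norm (largest absolute row sum). -/
def matrixNorm {k l : ℕ} (M : Matrix (Fin k) (Fin l) ℝ) : ℝ := ⨆ i, ∑ j, |M i j|

/-- All (complex) eigenvalues lie in the open left half-plane. -/
def IsHurwitz {k : ℕ} (A : Matrix (Fin k) (Fin k) ℝ) : Prop :=
  ∀ z ∈ spectrum ℂ (A.map (algebraMap ℝ ℂ)), z.re < 0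

/-- `[B, A B, …, A ^ (k - 1) B]` has rank `k`. -/
def IsControllable {k l : ℕ} (A : Matrix (Fin k) (Fin k) ℝ) (B : Matrix (Fin k) (Fin l) ℝ) :
    Prop :=
  (Matrix.of fun (i : Fin k) (q : Fin k × Fin l) => (A ^ (q.1 : ℕ) * B) i q.2).rank = k

/-- `[C; C A; …; C A ^ (k - 1)]` has rank `k`. -/
def IsObservable {k l : ℕ} (A : Matrix (Fin k) (Fin k) ℝ) (C : Matrix (Fin l) (Fin k) ℝ) :
    Prop :=
  (Matrix.of fun (q : Fin k × Fin l) (i : Fin k) => (C * A ^ (q.1 : ℕ)) q.2 i).rank = k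

/-- The Moore–Penrose (left) inverse of a matrix of full column rank. -/
def leftPinv {k l : ℕ} (N : Matrix (Fin k) (Fin l) ℝ) : Matrix (Fin l) (Fin k) ℝ :=
  (Nᵀ * N)⁻¹ * Nᵀ

/-- Largest eigenvalue of a symmetric matrix. -/
def eigMax {k : ℕ} (P : Matrix (Fin k) (Fin k) ℝ) : ℝ := sSup (spectrum ℝ P)

/-- Smallest eigenvalue of a symmetric matrix. -/
def eigMin {k : ℕ} (P : Matrix (Fin k) (Fin k) ℝ) : ℝ := sInf (spectrum ℝ P)

/-- The truncated norm: the `L^∞` norm over `[0, τ]` of a vector signal. -/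
def truncNorm {k : ℕ} (τ : ℝ) (x : ℝ → Fin k → ℝ) : ℝ≥0∞ :=
  eLpNorm x ∞ (volume.restrict (Set.Icc 0 τ))

/-! ### Rational transfer matrices -/

/-- A `k × l` transfer matrix: a matrix of real rational functions of `s`. -/
abbrev TransferMatrix (k l : ℕ) : Type := Matrix (Fin k) (Fin l) (RatFunc ℝ)

/-- A real matrix as a constant transfer matrix. -/
def const {k l : ℕ} (M : Matrix (Fin k) (Fin l) ℝ) : TransferMatrix k l := M.map RatFunc.C

/-- `(s I - A)⁻¹`. -/
def resolvent {k : ℕ} (A : Matrix (Fin k) (Fin k) ℝ) : TransferMatrix k k :=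
  ((RatFunc.X : RatFunc ℝ) • (1 : TransferMatrix k k) - const A)⁻¹

/-- Every pole of every entry lies in the open left half-plane. -/
def IsStable {k l : ℕ} (G : TransferMatrix k l) : Prop :=
  ∀ i j, ∀ z : ℂ, Polynomial.aeval z (G i j).denom = 0 → z.re < 0

/-- Every entry has a numerator of smaller degree than its denominator. -/
def IsStrictlyProper {k l : ℕ} (G : TransferMatrix k l) : Prop :=
  ∀ i j, (G i j).num.degree < (G i j).denom.degree

/-- The value `G(0)`. -/
def evalZero {k l : ℕ} (G : TransferMatrix k l) : Matrix (Fin k) (Fin l) ℝ :=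
  G.map (RatFunc.eval (RingHom.id ℝ) 0)

/-- `W` is a right interactor of `M₀`: the limit of `M₀(s) W(s)` as `s → ∞` exists and has full
(column) rank. -/
def IsRightInteractor {k l : ℕ} (M₀ : TransferMatrix k l) (W : TransferMatrix l l) : Prop :=
  ∃ E : Matrix (Fin k) (Fin l) ℝ, E.rank = l ∧ ∀ i j,
    Tendsto (fun s : ℂ => RatFunc.eval (algebraMap ℝ ℂ) s ((M₀ * W) i j))
      (Bornology.cobounded ℂ) (𝓝 (E i j : ℂ))

/-- The expansion of a rational function at infinity, as a Laurent series in `1 / s`: the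
coefficient of index `k` is the coefficient of `s ^ (-k)`. -/
def expansionAtInfinity (g : RatFunc ℝ) : LaurentSeries ℝ :=
  RatFunc.eval (HahnSeries.C : ℝ →+* LaurentSeries ℝ) (HahnSeries.single (-1 : ℤ) (1 : ℝ)) g

/-- The direct feedthrough `g(∞)` of a proper rational function `g`. -/
def feedthrough (g : RatFunc ℝ) : ℝ := (expansionAtInfinity g).coeff 0

/-- The impulse response (inverse Laplace transform) of the strictly proper part of `g`: as
`s ^ (-(k + 1))` is the Laplace transform of `t ^ k / k!`, it is `∑ k, g_{k+1} t ^ k / k!` for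
`g(s) = g_0 + ∑ k, g_{k+1} s ^ (-(k + 1))`. -/
def impulseResponse (g : RatFunc ℝ) (t : ℝ) : ℝ :=
  ∑' k : ℕ, (expansionAtInfinity g).coeff ((k : ℤ) + 1) * t ^ k / (k.factorial : ℝ)

/-- The `L¹` norm of a stable proper transfer function: total variation of the impulse response
`g_0 δ(t) + h(t)`. -/
def l1NormEntry (g : RatFunc ℝ) : ℝ :=
  |feedthrough g| + ∫ t in Set.Ioi (0 : ℝ), |impulseResponse g t|

/-- The `L¹` norm of a stable proper transfer matrix: the largest row sum. -/
def l1Norm {k l : ℕ} (G : TransferMatrix k l) : ℝ := ⨆ i, ∑ j, l1NormEntry (G i j)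

/-- The signal `y` with `y(s) = G(s) v(s)`: the zero-state response (convolution with the impulse
response) of a proper transfer matrix `G` to the input `v` on `[0, ∞)`. -/
def response {k l : ℕ} (G : TransferMatrix k l) (v : ℝ → Fin l → ℝ) (t : ℝ) : Fin k → ℝ :=
  fun i => ∑ j, (feedthrough (G i j) * v t j +
    ∫ s in (0 : ℝ)..t, impulseResponse (G i j) (t - s) * v s j)

/-! ### The plant, the controller design and the reference system -/

/-- The data of the problem: `n` states, `m` inputs, `p` outputs, an interactor of order `nz` and
`mr` reference commands. The conditions on the data are in `Admissible`. -/
structure Design (n m p nz mr : ℕ) where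
  /-- plant matrices -/
  Am : Matrix (Fin n) (Fin n) ℝ
  Bm : Matrix (Fin n) (Fin m) ℝ
  Cm : Matrix (Fin p) (Fin n) ℝ
  /-- bounds of the unknown input gain -/
  ωl : ℝ
  ωu : ℝ
  /-- matched uncertainty and its known bounds -/
  f : (Fin n → ℝ) → ℝ → Fin m → ℝ
  b₀ : ℝ
  d : ℝ → ℝ
  b : ℝ → ℝ
  /-- bound of the initial condition of the plant, and the small constant `γ̄` -/
  ρ₀ : ℝ
  γbar : ℝ
  /-- realization of `Z(s)`, and the associated matrices `T_z`, `B̄` -/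
  Az : Matrix (Fin nz) (Fin nz) ℝ
  Bz : Matrix (Fin nz) (Fin m) ℝ
  Cz : Matrix (Fin m) (Fin nz) ℝ
  Dz : Matrix (Fin m) (Fin m) ℝ
  Tz : Matrix (Fin n) (Fin nz) ℝ
  Bbar : Matrix (Fin n) (Fin m) ℝ
  /-- predictor gain and Lyapunov matrices -/
  Kv : Matrix (Fin n) (Fin p) ℝ
  Py : Matrix (Fin p) (Fin p) ℝ
  Pv : Matrix (Fin n) (Fin n) ℝ
  Q : Matrix (Fin n) (Fin n) ℝ
  εq : ℝ
  α : ℝ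
  /-- filter, feed-forward gain and reference command -/
  D : TransferMatrix m m
  Kg : Matrix (Fin m) (Fin mr) ℝ
  r : ℝ → Fin mr → ℝ
  ρr : ℝ

namespace Design

variable {n m p nz mr : ℕ} (S : Design n m p nz mr)

/-- `H₀(s) = (s I - A_m)⁻¹ B_m`. -/
def H₀ : TransferMatrix n m := resolvent S.Am * const S.Bm

/-- `M(s) = C_m (s I - A_m)⁻¹ B_m`. -/
def M : TransferMatrix p m := const S.Cm * resolvent S.Am * const S.Bm

/-- `Z(s) = C_z (s I - A_z)⁻¹ B_z + D_z`. -/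
def Z : TransferMatrix m m := const S.Cz * resolvent S.Az * const S.Bz + const S.Dz

/-- `H = B̄ (C_m B̄)†`. -/
def H : Matrix (Fin n) (Fin p) ℝ := S.Bbar * leftPinv (S.Cm * S.Bbar)

/-- `A_H = (I - H C_m) A_m`. -/
def AH : Matrix (Fin n) (Fin n) ℝ := (1 - S.H * S.Cm) * S.Am

/-- `A_v = A_H + K_v C_m`. -/
def Av : Matrix (Fin n) (Fin n) ℝ := S.AH + S.Kv * S.Cm

/-- `P̄_v = (I - H C_m)ᵀ P_v (I - H C_m)`. -/
def Pvbar : Matrix (Fin n) (Fin n) ℝ := (1 - S.H * S.Cm)ᵀ * S.Pv * (1 - S.H * S.Cm)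

/-- `L_δ = (δ + γ̄) / δ * d_{δ + γ̄}`. -/
def L (δ : ℝ) : ℝ := (δ + S.γbar) / δ * S.d (δ + S.γbar)

/-- `κ_m = sup_{t ≥ 0} ‖exp (A_m t)‖`. -/
def κm : ℝ := ⨆ t : Set.Ici (0 : ℝ), matrixNorm (NormedSpace.exp ((t : ℝ) • S.Am))

def κy : ℝ := Real.sqrt (n * (eigMax S.Pvbar / eigMin S.Py))

def κv : ℝ := Real.sqrt (n * (eigMax S.Pvbar / eigMin S.Pv))

/-- `C₀(s) = D(s) (I + ω D(s))⁻¹`. -/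
def C₀ (ω : ℝ) : TransferMatrix m m := S.D * (1 + RatFunc.C ω • S.D)⁻¹

/-- `C(s) = ω C₀(s)`. -/
def C (ω : ℝ) : TransferMatrix m m := RatFunc.C ω • S.C₀ ω

/-- `C₁(s) = (s + α) C₀(s) Z⁻¹(s) (C_m B̄)†`. -/
def C₁ (ω : ℝ) : TransferMatrix m p :=
  (RatFunc.X + RatFunc.C S.α) • (S.C₀ ω * S.Z⁻¹ * const (leftPinv (S.Cm * S.Bbar)))

/-- `C₂(s) = C₀(s) Z⁻¹(s) (C_m B̄)† C_m A_m`. -/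
def C₂ (ω : ℝ) : TransferMatrix m n :=
  S.C₀ ω * S.Z⁻¹ * const (leftPinv (S.Cm * S.Bbar) * S.Cm * S.Am)

def Hr (ω : ℝ) : TransferMatrix n mr := S.H₀ * S.C ω * const S.Kg

def H₁ (ω : ℝ) : TransferMatrix n p := RatFunc.C ω • (S.H₀ * S.C₁ ω)

def H₂ (ω : ℝ) : TransferMatrix n n := RatFunc.C ω • (S.H₀ * S.C₂ ω)

/-- `G(s) = H₀(s) (I - C(s))`. -/
def G (ω : ℝ) : TransferMatrix n m := S.H₀ * (1 - S.C ω)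

/-- The `L^∞` norm over `[0, ∞)` of the reference command. -/
def rNorm : ℝ := (eLpNorm S.r ∞ (volume.restrict (Set.Ici 0))).toReal

def ρext (ω : ℝ) : ℝ := l1Norm (S.Hr ω) * S.rNorm + l1Norm (S.G ω) * S.b₀

def κx (ω : ℝ) : ℝ := l1Norm (S.H₁ ω) * S.κy + l1Norm (S.H₂ ω) * S.κv

def ρint (ω : ℝ) : ℝ := (S.κm + S.κx ω) * S.ρ₀

def ρrx (ω : ℝ) : ℝ := S.ρr - S.ρint ω / (1 - l1Norm (S.G ω) * S.L S.ρr)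

def ρru (ω : ℝ) : ℝ :=
  l1Norm (S.C₀ ω) * (S.L S.ρr * S.ρrx ω + S.b₀) + l1Norm (S.C₀ ω * const S.Kg) * S.rNorm

/-- The standing assumptions on the plant: `A_m` is Hurwitz, `(A_m, B_m, C_m)` is minimal, `M(s)`
has full normal column rank and no unstable transmission zeros, the range of the input gain is a
compact interval of positive numbers, and `f` is semi-globally Lipschitz. -/
structure PlantAssumptions : Prop where
  m_le_p : m ≤ p
  Am_hurwitz : IsHurwitz S.Am
  controllable : IsControllable S.Am S.Bm
  observable : IsObservable S.Am S.Cm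
  full_rank : S.M.rank = m
  /-- The transmission zeros are the points where the system matrix drops rank. -/
  no_unstable_zeros : ∀ s : ℂ, 0 ≤ s.re →
    (Matrix.fromBlocks (s • 1 - S.Am.map (algebraMap ℝ ℂ)) (S.Bm.map (algebraMap ℝ ℂ))
      (-(S.Cm.map (algebraMap ℝ ℂ))) 0).rank = n + m
  ωl_pos : 0 < S.ωl
  ωl_lt_ωu : S.ωl < S.ωu
  b₀_pos : 0 < S.b₀
  f_zero : ∀ t, 0 ≤ t → ‖S.f 0 t‖ < S.b₀
  d_pos : ∀ δ, 0 < δ → 0 < S.d δ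
  b_pos : ∀ δ, 0 < δ → 0 < S.b δ
  /-- `‖∂f/∂x‖ ≤ d_δ` for `‖x‖ < δ`. -/
  f_space : ∀ δ, 0 < δ → ∀ x, ‖x‖ < δ → ∀ t, 0 ≤ t →
    DifferentiableAt ℝ (fun y => S.f y t) x ∧ ‖fderiv ℝ (fun y => S.f y t) x‖ ≤ S.d δ
  /-- `‖∂f/∂t‖ ≤ b_δ` for `‖x‖ < δ`. -/
  f_time : ∀ δ, 0 < δ → ∀ x, ‖x‖ < δ → ∀ t, 0 ≤ t →
    DifferentiableWithinAt ℝ (S.f x) (Set.Ici 0) t ∧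
      ‖derivWithin (S.f x) (Set.Ici 0) t‖ ≤ S.b δ

/-- `Z⁻¹(s)` is a right interactor of `s M(s)`; `(A_z, B_z, C_z, D_z)` is a minimal stable
realization of `Z(s)` without finite zeros, with associated matrices `T_z` and `B̄`. -/
structure InteractorConditions : Prop where
  interactor : IsRightInteractor ((RatFunc.X : RatFunc ℝ) • S.M) S.Z⁻¹
  Az_hurwitz : IsHurwitz S.Az
  controllable : IsControllable S.Az S.Bz
  observable : IsObservable S.Az S.Cz
  no_zeros : ∀ s : ℂ,
    (Matrix.fromBlocks (-(s • 1) + S.Az.map (algebraMap ℝ ℂ)) (S.Bz.map (algebraMap ℝ ℂ))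
      (S.Cz.map (algebraMap ℝ ℂ)) (S.Dz.map (algebraMap ℝ ℂ))).det ≠ 0
  Tz_rank : S.Tz.rank = nz
  Am_Tz : S.Am * S.Tz = S.Tz * S.Az + S.Bbar * S.Cz
  Cm_Am_Tz : S.Cm * S.Am * S.Tz = S.Cm * S.Bbar * S.Cz
  Bm_eq : S.Bm = S.Tz * S.Bz + S.Bbar * S.Dz
  Cm_Bm : S.Cm * S.Bm = S.Cm * S.Bbar * S.Dz

/-- The design constraints. -/
structure Admissible : Prop where
  plant : S.PlantAssumptions
  interactor : S.InteractorConditions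
  ρ₀_pos : 0 < S.ρ₀
  γbar_pos : 0 < S.γbar
  Av_hurwitz : IsHurwitz S.Av
  Py_posDef : S.Py.PosDef
  Pv_posDef : S.Pv.PosDef
  Q_posDef : S.Q.PosDef
  εq_pos : 0 < S.εq
  εq_lt : S.εq < eigMin S.Q
  lyapunov : S.Avᵀ * S.Pv + S.Pv * S.Av = -S.Q
  α_pos : 0 < S.α
  /-- The reference command is a bounded (measurable) signal on `[0, ∞)`. -/
  r_bounded : MemLp S.r ∞ (volume.restrict (Set.Ici 0))
  filter_wellPosed : ∀ ω ∈ Set.Icc S.ωl S.ωu, (1 + RatFunc.C ω • S.D).det ≠ 0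
  filter_stable : ∀ ω ∈ Set.Icc S.ωl S.ωu, IsStable (S.C ω)
  filter_dcGain : ∀ ω ∈ Set.Icc S.ωl S.ωu, evalZero (S.C ω) = 1
  filter_strictlyProper : ∀ ω ∈ Set.Icc S.ωl S.ωu, IsStrictlyProper (S.C ω * S.Z⁻¹)
  ρr_pos : 0 < S.ρr
  /-- The `L¹`-norm condition. -/
  l1_condition : ∀ ω ∈ Set.Icc S.ωl S.ωu,
    l1Norm (S.G ω) < (S.ρr - S.ρext ω - S.ρint ω) / (S.L S.ρr * S.ρr)

/-- `(x, u)` solves the closed-loop reference system on `[0, τ]` for the input gain `ω`: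
`x' = A_m x + B_m (ω u + f(x, t))`, `x(0) = 0`, `u(s) = C₀(s) (K_g r(s) - η(s))`, where `η(s)` is
the Laplace transform of `f(x(t), t)`. -/
structure IsReferenceSolution (ω τ : ℝ) (x : ℝ → Fin n → ℝ) (u : ℝ → Fin m → ℝ) : Prop where
  init : x 0 = 0
  ode : ∀ t ∈ Set.Icc 0 τ,
    HasDerivWithinAt x (S.Am *ᵥ x t + S.Bm *ᵥ (ω • u t + S.f (x t) t)) (Set.Icc 0 τ) t
  control : ∀ t ∈ Set.Icc 0 τ,
    u t = response (S.C₀ ω) (fun s => S.Kg *ᵥ S.r s - S.f (x s) s) t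

end Design

end L1Adaptive

end

/-! Inserting the control law into the plant gives the loop equation `x = H_r r + G η` with `η =
f(x, ·)`. While `‖x‖ ≤ ρ_r`, the mean value inequality gives `‖η‖ ≤ L ‖x‖ + b₀`, where `L =
L_{ρ_r}`. Hence a bound `R ≤ ρ_r` on the past of `x` yields `‖x(t)‖ ≤ ρ_ext + ‖G‖ L R`. The `L¹`
condition says `ρ_ext + ‖G‖ L ρ_r < ρ_r - ρ_int`, so a continuous trajectory starting at 0 has no
first time of reaching `ρ_r`. Once `‖x‖ < ρ_r` on all of `[0, τ]`, taking for `R` the maximum of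
`‖x‖` gives `‖x‖ ≤ ρ_ext / (1 - ‖G‖ L)`, which the same condition places below `ρ_rx`. The bound on
`u` follows by applying `C₀` and `C₀ K_g` to the bounded signals. This argument is in
`norm_state_le_of_forall_lt`, `norm_state_lt`, `norm_state_le` and `norm_control_le`.

The remaining work justifies the two facts used about transfer matrices. The estimate
`norm_response_le` needs integrable impulse responses. The coefficients of the expansion at infinity
satisfy a linear recurrence whose characteristic polynomial is the denominator, and removing its
complex roots one at a time turns the recurrence into scalar first-order equations with
exponentially decaying solutions.

The loop equation `state_eq` is obtained without composing convolutions. Differentiating a response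
amounts to multiplying the transfer matrix by `s`, and `s H₀ = A_m H₀ + B_m`, so `H_r r + G η`
solves the same initial value problem as `x`; uniqueness for linear equations identifies them. The
required properness comes from the filter: `C Z⁻¹` is strictly proper and `Z` is proper, so `C` and
`C₀` are strictly proper. -/

noncomputable section

namespace L1Adaptive

/-! ### Exponential generating functions of sequences of geometric growth -/

section ExpSeries

variable {E : Type*} [NormedAddCommGroup E]

/-- The exponential generating function `∑ k, t ^ k / k! • c k`. -/
def expSeries [NormedSpace ℝ E] (c : ℕ → E) (t : ℝ) : E := ∑' k : ℕ, (t ^ k / (k.factorial : ℝ)) • c k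

/-- `‖c k‖ ≤ K R ^ k` for some `K` and `R`. -/
def HasGeometricGrowth (c : ℕ → E) : Prop :=
  ∃ K R : ℝ, 0 ≤ K ∧ 0 ≤ R ∧ ∀ k, ‖c k‖ ≤ K * R ^ k

theorem HasGeometricGrowth.shift {c : ℕ → E} (hc : HasGeometricGrowth c) :
    HasGeometricGrowth fun k => c (k + 1) := by
  obtain ⟨K, R, hK, hR, h⟩ := hc
  refine ⟨K * R, R, by positivity, hR, fun k => (h (k + 1)).trans_eq (by ring)⟩

variable [NormedSpace ℝ E]

theorem norm_expSeries_term_le {c : ℕ → E} {K R T t : ℝ} (hc : ∀ k, ‖c k‖ ≤ K * R ^ k)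
    (ht : |t| ≤ T) (k : ℕ) :
    ‖(t ^ k / (k.factorial : ℝ)) • c k‖ ≤ K * ((T * R) ^ k / (k.factorial : ℝ)) := by
  rw [norm_smul, norm_div, norm_pow, Real.norm_eq_abs, Real.norm_natCast]
  have hT : |t| ^ k ≤ T ^ k := pow_le_pow_left₀ (abs_nonneg t) ht k
  calc |t| ^ k / (k.factorial : ℝ) * ‖c k‖ ≤ T ^ k / (k.factorial : ℝ) * (K * R ^ k) := by
        have := hc k
        have hT0 : 0 ≤ T := (abs_nonneg t).trans ht
        gcongr
    _ = _ := by rw [mul_pow]; ring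

variable [CompleteSpace E]

theorem HasGeometricGrowth.summable {c : ℕ → E} (hc : HasGeometricGrowth c) (t : ℝ) :
    Summable fun k : ℕ => (t ^ k / (k.factorial : ℝ)) • c k := by
  obtain ⟨K, R, -, -, h⟩ := hc
  exact .of_norm_bounded ((Real.summable_pow_div_factorial (|t| * R)).mul_left K)
    fun k => norm_expSeries_term_le h le_rfl k

theorem hasDerivAt_pow_div_factorial (k : ℕ) (t : ℝ) :
    HasDerivAt (fun y : ℝ => y ^ (k + 1) / ((k + 1).factorial : ℝ))
      (t ^ k / (k.factorial : ℝ)) t := by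
  refine ((hasDerivAt_pow (k + 1) t).div_const _).congr_deriv ?_
  rw [Nat.factorial_succ]
  have : (k.factorial : ℝ) ≠ 0 := by positivity
  push_cast
  field_simp

theorem expSeries_eq_add {c : ℕ → E} (hc : HasGeometricGrowth c) (t : ℝ) :
    expSeries c t =
      c 0 + ∑' k : ℕ, (t ^ (k + 1) / ((k + 1).factorial : ℝ)) • c (k + 1) := by
  rw [expSeries, (hc.summable t).tsum_eq_zero_add]
  simp

theorem HasGeometricGrowth.hasDerivAt_expSeries {c : ℕ → E} (hc : HasGeometricGrowth c) (t : ℝ) :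
    HasDerivAt (expSeries c) (expSeries (fun k => c (k + 1)) t) t := by
  -- Splitting off the constant term leaves summands `y ^ (k + 1) / (k + 1)!`, whose derivatives are
  -- exactly the terms of the shifted series.
  have hfun : expSeries c = fun y =>
      c 0 + ∑' k : ℕ, (y ^ (k + 1) / ((k + 1).factorial : ℝ)) • c (k + 1) :=
    funext fun y => expSeries_eq_add hc y
  rw [hfun]
  refine HasDerivAt.const_add _ ?_
  obtain ⟨K, R, -, -, h⟩ := hc.shift
  -- Termwise differentiation on a ball around 0 that contains `t`; there the derivatives are
  -- dominated by an exponential series, and at 0 the series itself vanishes.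
  refine hasDerivAt_tsum_of_isPreconnected (t := Metric.ball 0 (|t| + 1)) (y₀ := 0)
    (g := fun k y => (y ^ (k + 1) / ((k + 1).factorial : ℝ)) • c (k + 1))
    (g' := fun k y => (y ^ k / (k.factorial : ℝ)) • c (k + 1))
    ((Real.summable_pow_div_factorial ((|t| + 1) * R)).mul_left K) Metric.isOpen_ball
    (convex_ball _ _).isPreconnected (fun k y _ => ?_) (fun k y hy => ?_) ?_ ?_ ?_
  · exact (hasDerivAt_pow_div_factorial k y).smul_const _
  · refine norm_expSeries_term_le h ?_ k
    simpa using (Metric.mem_ball.1 hy).le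
  · simp only [Metric.mem_ball, dist_self]; positivity
  · simp
  · simp

theorem expSeries_zero {c : ℕ → E} (hc : HasGeometricGrowth c) : expSeries c 0 = c 0 := by
  rw [expSeries_eq_add hc]; simp

theorem expSeries_add {c d : ℕ → E} (hc : HasGeometricGrowth c) (hd : HasGeometricGrowth d)
    (t : ℝ) : expSeries (fun k => c k + d k) t = expSeries c t + expSeries d t := by
  simp only [expSeries, smul_add]
  exact (hc.summable t).tsum_add (hd.summable t)

end ExpSeries

/-! ### Linear recurrences -/

section Recurrence

/-- The shift of sequences. -/
def shiftEnd : Module.End ℂ (ℕ → ℂ) := LinearMap.funLeft ℂ ℂ Nat.succ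

theorem shiftEnd_apply (c : ℕ → ℂ) (k : ℕ) : shiftEnd c k = c (k + 1) := rfl

theorem shiftEnd_pow_apply (c : ℕ → ℂ) (i k : ℕ) : (shiftEnd ^ i) c k = c (k + i) := by
  induction i generalizing k with
  | zero => rfl
  | succ i ih =>
    rw [pow_succ', Module.End.mul_apply, shiftEnd_apply, ih]
    congr 1
    omega

theorem aeval_shiftEnd_apply (D : Polynomial ℂ) (c : ℕ → ℂ) (k : ℕ) :
    Polynomial.aeval shiftEnd D c k = D.sum fun i a => a * c (k + i) := by
  rw [Polynomial.aeval_eq_sum_range, Polynomial.sum_over_range _ (fun _ => by simp)]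
  simp [shiftEnd_pow_apply]

theorem HasGeometricGrowth.of_first_order {c w : ℕ → ℂ} {a : ℂ}
    (h : ∀ k, c (k + 1) = a * c k + w k) (hw : HasGeometricGrowth w) : HasGeometricGrowth c := by
  obtain ⟨K, R, hK, hR, hw⟩ := hw
  -- The base dominates `R`, which absorbs the forcing term, and exceeds `‖a‖ + 1`, which closes the
  -- induction.
  refine ⟨‖c 0‖ + K, ‖a‖ + R + 1, by positivity, by positivity, fun k => ?_⟩
  induction k with
  | zero => simpa using hK
  | succ k ih =>
    have hpow : R ^ k ≤ (‖a‖ + R + 1) ^ k :=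
      pow_le_pow_left₀ hR (by linarith [norm_nonneg a]) k
    have h0 : 0 ≤ R ^ k := pow_nonneg hR k
    calc ‖c (k + 1)‖ ≤ ‖a‖ * ‖c k‖ + ‖w k‖ := by
          rw [h k, ← norm_mul]; exact norm_add_le _ _
      _ ≤ ‖a‖ * ((‖c 0‖ + K) * (‖a‖ + R + 1) ^ k) +
            (‖c 0‖ + K) * (‖a‖ + R + 1) ^ k := by
          refine add_le_add (by gcongr) ((hw k).trans ?_)
          have := norm_nonneg (c 0)
          gcongr
          linarith
      _ ≤ (‖c 0‖ + K) * (‖a‖ + R + 1) ^ (k + 1) := by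
          have : 0 ≤ (‖c 0‖ + K) * (‖a‖ + R + 1) ^ k * R := by positivity
          rw [pow_succ]
          nlinarith

/-- Polynomials in the shift commute, so one linear factor can be applied to the sequence first;
this removes one root from the recurrence. -/
theorem aeval_shiftEnd_X_sub_C_mul (a : ℂ) (D : Polynomial ℂ) (c : ℕ → ℂ) :
    Polynomial.aeval shiftEnd ((Polynomial.X - Polynomial.C a) * D) c =
      Polynomial.aeval shiftEnd D (fun k => c (k + 1) - a * c k) := by
  rw [mul_comm, map_mul, Module.End.mul_apply]
  congr 1
  ext k
  simp [shiftEnd_apply]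

theorem HasGeometricGrowth.of_prod_X_sub_C (s : Multiset ℂ) (c : ℕ → ℂ)
    (hc : Polynomial.aeval shiftEnd (s.map fun a => Polynomial.X - Polynomial.C a).prod c = 0) :
    HasGeometricGrowth c := by
  induction s using Multiset.induction generalizing c with
  | empty =>
    have : c = 0 := by simpa using hc
    exact ⟨0, 0, le_rfl, le_rfl, by simp [this]⟩
  | cons a s ih =>
    rw [Multiset.map_cons, Multiset.prod_cons, aeval_shiftEnd_X_sub_C_mul] at hc
    exact .of_first_order (a := a) (fun k => by ring) (ih _ hc)

/-- Variation of constants: `e^{-a t} h` has derivative `e^{-a t} w`. The strict gap between `Re a`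
and `-ε` keeps the rate `ε` without polynomial factors, so repeated roots need no separate
treatment. -/
theorem norm_le_exp_of_first_order {h w : ℝ → ℂ} {a : ℂ} {ε K : ℝ} (hK : 0 ≤ K)
    (ha : a.re < -ε) (hh : ∀ t, HasDerivAt h (a * h t + w t) t)
    (hw : ∀ t, 0 ≤ t → ‖w t‖ ≤ K * Real.exp (-ε * t)) :
    ∃ K', 0 ≤ K' ∧ ∀ t, 0 ≤ t → ‖h t‖ ≤ K' * Real.exp (-ε * t) := by
  set μ := -ε - a.re with hμ
  have hμ0 : 0 < μ := by linarith
  have hexp : ∀ t : ℝ, HasDerivAt (fun y : ℝ => Complex.exp (-a * y))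
      (-a * Complex.exp (-a * t)) t := fun t => by
    have h1 : HasDerivAt (fun y : ℝ => -a * (y : ℂ)) (-a) t := by
      simpa using (Complex.ofRealCLM.hasDerivAt (x := t)).const_mul (-a)
    refine h1.cexp.congr_deriv (by ring)
  have hnorm : ∀ t : ℝ, ‖Complex.exp (-a * t)‖ = Real.exp (-a.re * t) := fun t => by
    rw [Complex.norm_exp]; simp
  have hψ : ∀ t : ℝ, HasDerivAt (fun y : ℝ => Complex.exp (-a * y) * h y)
      (Complex.exp (-a * t) * w t) t := fun t =>
    ((hexp t).mul (hh t)).congr_deriv (by ring)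
  refine ⟨‖h 0‖ + K / μ, by positivity, fun t ht => ?_⟩
  -- The comparison function is an antiderivative of `K e^{μ y}`, raised by `‖h 0‖` so that it
  -- dominates at 0.
  have key := image_norm_le_of_norm_deriv_right_le_deriv_boundary (a := 0) (b := t)
    (f := fun y : ℝ => Complex.exp (-a * y) * h y)
    (f' := fun y : ℝ => Complex.exp (-a * y) * w y)
    (B := fun y => ‖h 0‖ + K / μ * Real.exp (μ * y)) (B' := fun y => K * Real.exp (μ * y))
    (fun y _ => (hψ y).continuousAt.continuousWithinAt)
    (fun y _ => (hψ y).hasDerivWithinAt) ?_ ?_ ?_ (Set.right_mem_Icc.2 ht)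
  · simp only [norm_mul, hnorm] at key
    have hE : ‖h t‖ = Real.exp (a.re * t) * (Real.exp (-a.re * t) * ‖h t‖) := by
      rw [← mul_assoc, ← Real.exp_add]; simp
    have h1 : Real.exp (a.re * t) ≤ Real.exp (-ε * t) :=
      Real.exp_le_exp.2 (mul_le_mul_of_nonneg_right ha.le ht)
    have h2 : Real.exp (a.re * t) * Real.exp (μ * t) = Real.exp (-ε * t) := by
      rw [← Real.exp_add, hμ]; ring_nf
    calc ‖h t‖ ≤ Real.exp (a.re * t) * (‖h 0‖ + K / μ * Real.exp (μ * t)) := by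
          rw [hE]; gcongr
      _ = Real.exp (a.re * t) * ‖h 0‖ + K / μ * Real.exp (-ε * t) := by rw [← h2]; ring
      _ ≤ Real.exp (-ε * t) * ‖h 0‖ + K / μ * Real.exp (-ε * t) := by gcongr
      _ = _ := by ring
  · have : 0 ≤ K / μ := by positivity
    simpa using this
  · intro y
    have h1 : HasDerivAt (fun y : ℝ => μ * y) μ y := by
      simpa using (hasDerivAt_id y).const_mul μ
    refine ((h1.exp.const_mul (K / μ)).const_add _).congr_deriv ?_
    field_simp
  · intro y hy
    rw [norm_mul, hnorm]
    refine (mul_le_mul_of_nonneg_left (hw y hy.1) (Real.exp_nonneg _)).trans_eq ?_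
    rw [mul_left_comm, ← Real.exp_add, hμ]
    ring_nf

/-- Induction on the roots. The sequence `c (k + 1) - a c k` satisfies the recurrence without the
root `a`, and its generating function is the forcing term in `h' = a h + w` for the generating
function `h` of `c`. -/
theorem exists_norm_expSeries_le_exp (s : Multiset ℂ) (ε : ℝ) (hs : ∀ a ∈ s, a.re < -ε)
    (c : ℕ → ℂ)
    (hc : Polynomial.aeval shiftEnd (s.map fun a => Polynomial.X - Polynomial.C a).prod c = 0) :
    ∃ K, 0 ≤ K ∧ ∀ t, 0 ≤ t → ‖expSeries c t‖ ≤ K * Real.exp (-ε * t) := by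
  induction s using Multiset.induction generalizing c with
  | empty =>
    have : c = 0 := by simpa using hc
    exact ⟨0, le_rfl, by simp [this, expSeries]⟩
  | cons a s ih =>
    have hg := HasGeometricGrowth.of_prod_X_sub_C _ _ hc
    rw [Multiset.map_cons, Multiset.prod_cons, aeval_shiftEnd_X_sub_C_mul] at hc
    have hgw := HasGeometricGrowth.of_prod_X_sub_C _ _ hc
    obtain ⟨K, hK, hw⟩ := ih (fun b hb => hs b (Multiset.mem_cons_of_mem hb)) _ hc
    refine norm_le_exp_of_first_order hK (hs a (Multiset.mem_cons_self a s)) (fun t => ?_) hw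
    refine (hg.hasDerivAt_expSeries t).congr_deriv ?_
    have h1 : (fun k => c (k + 1)) = fun k => a * c k + (c (k + 1) - a * c k) := by
      ext k; ring
    have hga : HasGeometricGrowth fun k => a * c k := by
      obtain ⟨K, R, hK, hR, h⟩ := hg
      refine ⟨‖a‖ * K, R, by positivity, hR, fun k => ?_⟩
      rw [norm_mul, mul_assoc]
      exact mul_le_mul_of_nonneg_left (h k) (norm_nonneg a)
    rw [h1, expSeries_add hga hgw, add_left_inj]
    rw [expSeries, expSeries, ← tsum_mul_left]
    exact tsum_congr fun k => (mul_smul_comm _ a (c k)).symm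

/-- Finitely many points of the open left half-plane are bounded away from the imaginary axis. -/
theorem exists_lt_neg_of_re_neg (s : Multiset ℂ) (hs : ∀ a ∈ s, a.re < 0) :
    ∃ ε, 0 < ε ∧ ∀ a ∈ s, a.re < -ε := by
  induction s using Multiset.induction with
  | empty => exact ⟨1, one_pos, by simp⟩
  | cons a s ih =>
    obtain ⟨ε, hε, h⟩ := ih fun b hb => hs b (Multiset.mem_cons_of_mem hb)
    have ha := hs a (Multiset.mem_cons_self a s)
    refine ⟨min ε (-a.re / 2), lt_min hε (by linarith), fun b hb => ?_⟩
    rcases Multiset.mem_cons.1 hb with rfl | hb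
    · have := min_le_right ε (-b.re / 2); linarith
    · have := min_le_left ε (-a.re / 2); linarith [h b hb]

theorem aeval_shiftEnd_prod_roots {D : Polynomial ℂ} (hD : D ≠ 0) {c : ℕ → ℂ}
    (hc : Polynomial.aeval shiftEnd D c = 0) :
    Polynomial.aeval shiftEnd (D.roots.map fun a => Polynomial.X - Polynomial.C a).prod c = 0 := by
  have h := (IsAlgClosed.splits D).eq_prod_roots
  rw [h, map_mul, Module.End.mul_apply, Polynomial.aeval_C, Module.algebraMap_end_apply] at hc
  exact (smul_eq_zero.1 hc).resolve_left (Polynomial.leadingCoeff_ne_zero.2 hD)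

theorem HasGeometricGrowth.of_recurrence {D : Polynomial ℂ} (hD : D ≠ 0) {c : ℕ → ℂ}
    (hc : Polynomial.aeval shiftEnd D c = 0) : HasGeometricGrowth c :=
  .of_prod_X_sub_C _ _ (aeval_shiftEnd_prod_roots hD hc)

theorem exists_norm_expSeries_le_exp_of_recurrence {D : Polynomial ℂ} (hD : D ≠ 0)
    (hroots : ∀ z, D.eval z = 0 → z.re < 0) {c : ℕ → ℂ}
    (hc : Polynomial.aeval shiftEnd D c = 0) :
    ∃ K ε, 0 < ε ∧ ∀ t, 0 ≤ t → ‖expSeries c t‖ ≤ K * Real.exp (-ε * t) := by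
  obtain ⟨ε, hε, h⟩ := exists_lt_neg_of_re_neg D.roots
    fun a ha => hroots a ((Polynomial.mem_roots hD).1 ha)
  obtain ⟨K, -, hK⟩ :=
    exists_norm_expSeries_le_exp _ ε h c (aeval_shiftEnd_prod_roots hD hc)
  exact ⟨K, ε, hε, hK⟩

end Recurrence

/-! ### The expansion at infinity -/

section Expansion

/-- The image of a polynomial in `s` among the Laurent series in `1 / s`. -/
abbrev polyAtInfinity (q : Polynomial ℝ) : LaurentSeries ℝ :=
  q.eval₂ (HahnSeries.C : ℝ →+* LaurentSeries ℝ) (HahnSeries.single (-1 : ℤ) (1 : ℝ))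

/-- Multiplication by `s` shifts coefficients by one index, so a polynomial factor acts as a
difference operator. The recurrence for the impulse response rests on this. -/
theorem polyAtInfinity_mul_coeff (q : Polynomial ℝ) (F : LaurentSeries ℝ) (k : ℤ) :
    (polyAtInfinity q * F).coeff k = q.sum fun i a => a * F.coeff (k + i) := by
  rw [polyAtInfinity, Polynomial.eval₂_eq_sum, Polynomial.sum, Finset.sum_mul, Polynomial.sum]
  rw [HahnSeries.coeff_sum]
  refine Finset.sum_congr rfl fun i _ => ?_
  rw [HahnSeries.single_pow, HahnSeries.C_apply, HahnSeries.single_mul_single,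
    HahnSeries.coeff_single_mul]
  simp

theorem polyAtInfinity_coeff_neg (q : Polynomial ℝ) (i : ℕ) :
    (polyAtInfinity q).coeff (-(i : ℤ)) = q.coeff i := by
  have h := polyAtInfinity_mul_coeff q 1 (-(i : ℤ))
  rw [mul_one] at h
  rw [h, Polynomial.sum_def, Finset.sum_eq_single i]
  · simp
  · intro j _ hj
    rw [HahnSeries.coeff_one, if_neg (by omega), mul_zero]
  · intro hi
    rw [Polynomial.notMem_support_iff.1 hi, zero_mul]

theorem polyAtInfinity_coeff_pos (q : Polynomial ℝ) {k : ℤ} (hk : 0 < k) :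
    (polyAtInfinity q).coeff k = 0 := by
  have h := polyAtInfinity_mul_coeff q 1 k
  rw [mul_one] at h
  rw [h, Polynomial.sum_def]
  refine Finset.sum_eq_zero fun i _ => ?_
  rw [HahnSeries.coeff_one, if_neg (by omega), mul_zero]

theorem polyAtInfinity_ne_zero {q : Polynomial ℝ} (hq : q ≠ 0) : polyAtInfinity q ≠ 0 := by
  intro h
  apply hq
  ext i
  rw [← polyAtInfinity_coeff_neg, h]
  simp

theorem expansionAtInfinity_add (g h : RatFunc ℝ) :
    expansionAtInfinity (g + h) = expansionAtInfinity g + expansionAtInfinity h :=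
  RatFunc.eval_add _ _ (polyAtInfinity_ne_zero g.denom_ne_zero)
    (polyAtInfinity_ne_zero h.denom_ne_zero)

theorem expansionAtInfinity_mul (g h : RatFunc ℝ) :
    expansionAtInfinity (g * h) = expansionAtInfinity g * expansionAtInfinity h :=
  RatFunc.eval_mul _ _ (polyAtInfinity_ne_zero g.denom_ne_zero)
    (polyAtInfinity_ne_zero h.denom_ne_zero)

theorem expansionAtInfinity_zero : expansionAtInfinity 0 = 0 := RatFunc.eval_zero _ _

theorem polyAtInfinity_denom_mul (g : RatFunc ℝ) :
    polyAtInfinity g.denom * expansionAtInfinity g = polyAtInfinity g.num :=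
  mul_div_cancel₀ _ (polyAtInfinity_ne_zero g.denom_ne_zero)

theorem expansionAtInfinity_C_mul_coeff (a : ℝ) (g : RatFunc ℝ) (k : ℤ) :
    (expansionAtInfinity (RatFunc.C a * g)).coeff k = a * (expansionAtInfinity g).coeff k := by
  rw [expansionAtInfinity_mul, expansionAtInfinity, RatFunc.eval_C, HahnSeries.C_apply,
    HahnSeries.coeff_single_mul, sub_zero]

theorem expansionAtInfinity_X_mul_coeff (g : RatFunc ℝ) (k : ℤ) :
    (expansionAtInfinity (RatFunc.X * g)).coeff k = (expansionAtInfinity g).coeff (k + 1) := by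
  rw [expansionAtInfinity_mul, expansionAtInfinity, RatFunc.eval_X,
    HahnSeries.coeff_single_mul, one_mul, sub_neg_eq_add]

/-- A nonzero polynomial in `s` of degree `d` has order `-d` in `1 / s`. -/
theorem order_polyAtInfinity {q : Polynomial ℝ} (hq : q ≠ 0) :
    (polyAtInfinity q).order = -(q.natDegree : ℤ) := by
  apply le_antisymm
  · refine HahnSeries.order_le_of_coeff_ne_zero ?_
    rw [polyAtInfinity_coeff_neg]
    exact Polynomial.leadingCoeff_ne_zero.2 hq
  · by_contra! h
    have h0 := HahnSeries.coeff_order_eq_zero.not.2 (polyAtInfinity_ne_zero hq)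
    obtain ⟨i, hi⟩ := Int.exists_eq_neg_ofNat (a := (polyAtInfinity q).order) (by omega)
    rw [hi, polyAtInfinity_coeff_neg] at h0
    have := Polynomial.le_natDegree_of_ne_zero h0
    omega

end Expansion

/-! ### Properness -/

section Proper

open Classical in
/-- The valuation at infinity of rational functions: `g` is proper iff its value is at most `1`,
strictly proper iff it is less than `1`. -/
def valInfty : Valuation (RatFunc ℝ) (WithZero (Multiplicative ℤ)) := RatFunc.inftyValuation ℝ

theorem valInfty_of_ne_zero {g : RatFunc ℝ} (hg : g ≠ 0) :
    valInfty g = WithZero.exp g.intDegree := by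
  classical
  exact RatFunc.inftyValuation_of_nonzero ℝ hg

theorem valInfty_lt_one_iff (g : RatFunc ℝ) :
    valInfty g < 1 ↔ g.num.degree < g.denom.degree := by
  rcases eq_or_ne g 0 with rfl | hg
  · simp
  · rw [valInfty_of_ne_zero hg, ← WithZero.exp_zero, WithZero.exp_lt_exp, RatFunc.intDegree,
      Polynomial.degree_eq_natDegree (RatFunc.num_ne_zero hg),
      Polynomial.degree_eq_natDegree g.denom_ne_zero, Nat.cast_lt]
    omega

theorem valInfty_C_le (a : ℝ) : valInfty (RatFunc.C a) ≤ 1 := by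
  rcases eq_or_ne a 0 with rfl | ha
  · simp
  · rw [valInfty_of_ne_zero (by simpa using ha)]
    simp

theorem feedthrough_eq_zero {g : RatFunc ℝ} (hg : valInfty g < 1) : feedthrough g = 0 := by
  rcases eq_or_ne g 0 with rfl | h0
  · simp [feedthrough, expansionAtInfinity_zero]
  · have hnum := RatFunc.num_ne_zero h0
    have hE : expansionAtInfinity g ≠ 0 := fun h => polyAtInfinity_ne_zero hnum (by
      rw [← polyAtInfinity_denom_mul, h, mul_zero])
    -- Comparing orders shows that the expansion starts at index `deg denom - deg num`, which is
    -- positive.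
    have ho := congrArg HahnSeries.order (polyAtInfinity_denom_mul g)
    rw [HahnSeries.order_mul (polyAtInfinity_ne_zero g.denom_ne_zero) hE,
      order_polyAtInfinity g.denom_ne_zero, order_polyAtInfinity hnum] at ho
    have hd := Polynomial.natDegree_lt_natDegree hnum ((valInfty_lt_one_iff g).1 hg)
    exact HahnSeries.coeff_eq_zero_of_lt_order (by omega)

end Proper

/-! ### The impulse response -/

section Impulse

/-- The coefficients of `s ^ (-(k + 1))` in the expansion at infinity. -/
def markov (g : RatFunc ℝ) (k : ℕ) : ℝ := (expansionAtInfinity g).coeff ((k : ℤ) + 1)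

theorem impulseResponse_eq_expSeries (g : RatFunc ℝ) :
    impulseResponse g = expSeries (markov g) := by
  ext t
  rw [impulseResponse, expSeries]
  refine tsum_congr fun k => ?_
  rw [smul_eq_mul, markov]
  ring

/-- The denominator times the expansion is the numerator, a polynomial in `s`, hence without
coefficients at positive indices. The statement is over `ℂ` so that the denominator splits. -/
theorem markov_recurrence (g : RatFunc ℝ) :
    Polynomial.aeval shiftEnd (g.denom.map (algebraMap ℝ ℂ)) (fun k => (markov g k : ℂ)) = 0 := by
  ext k
  rw [aeval_shiftEnd_apply, Polynomial.sum_over_range _ (fun _ => by simp),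
    Polynomial.natDegree_map]
  have h := polyAtInfinity_mul_coeff g.denom (expansionAtInfinity g) ((k : ℤ) + 1)
  rw [polyAtInfinity_denom_mul, polyAtInfinity_coeff_pos _ (by omega),
    Polynomial.sum_over_range _ (fun _ => by simp)] at h
  have h' := congrArg (fun r : ℝ => (r : ℂ)) h
  simp only [Complex.ofReal_zero, Complex.ofReal_sum, Complex.ofReal_mul] at h'
  rw [Pi.zero_apply, h']
  refine Finset.sum_congr rfl fun i _ => ?_
  rw [Polynomial.coeff_map, markov]
  push_cast
  rw [add_right_comm]
  rfl

theorem denom_map_ne_zero (g : RatFunc ℝ) : g.denom.map (algebraMap ℝ ℂ) ≠ 0 :=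
  (Polynomial.map_ne_zero_iff (algebraMap ℝ ℂ).injective).2 g.denom_ne_zero

theorem markov_growth (g : RatFunc ℝ) : HasGeometricGrowth (markov g) := by
  obtain ⟨K, R, hK, hR, h⟩ :=
    HasGeometricGrowth.of_recurrence (denom_map_ne_zero g) (markov_recurrence g)
  exact ⟨K, R, hK, hR, fun k => by simpa using h k⟩

theorem expSeries_ofReal (c : ℕ → ℝ) (t : ℝ) :
    expSeries (fun k => (c k : ℂ)) t = ((expSeries c t : ℝ) : ℂ) := by
  rw [expSeries, expSeries, Complex.ofReal_tsum]
  refine tsum_congr fun k => ?_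
  simp

/-- Multiplication by `s` shifts the coefficients, and shifting the coefficients differentiates an
exponential generating function. -/
theorem hasDerivAt_impulseResponse (g : RatFunc ℝ) (t : ℝ) :
    HasDerivAt (impulseResponse g) (impulseResponse (RatFunc.X * g) t) t := by
  rw [impulseResponse_eq_expSeries, impulseResponse_eq_expSeries]
  have h : markov (RatFunc.X * g) = fun k => markov g (k + 1) := by
    ext k
    simp only [markov, expansionAtInfinity_X_mul_coeff]
    push_cast
    rfl
  rw [h]
  exact (markov_growth g).hasDerivAt_expSeries t

theorem continuous_impulseResponse (g : RatFunc ℝ) : Continuous (impulseResponse g) :=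
  continuous_iff_continuousAt.2 fun t => (hasDerivAt_impulseResponse g t).continuousAt

/-- This is the initial value theorem: both sides are the coefficient of `s⁻¹`. -/
theorem impulseResponse_at_zero (g : RatFunc ℝ) :
    impulseResponse g 0 = feedthrough (RatFunc.X * g) := by
  rw [impulseResponse_eq_expSeries, expSeries_zero (markov_growth g), markov, feedthrough,
    expansionAtInfinity_X_mul_coeff]
  simp

theorem impulseResponse_add (g h : RatFunc ℝ) (t : ℝ) :
    impulseResponse (g + h) t = impulseResponse g t + impulseResponse h t := by
  simp only [impulseResponse_eq_expSeries]
  rw [← expSeries_add (markov_growth g) (markov_growth h)]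
  congr 1
  ext k
  simp [markov, expansionAtInfinity_add]

theorem impulseResponse_C_mul (a : ℝ) (g : RatFunc ℝ) (t : ℝ) :
    impulseResponse (RatFunc.C a * g) t = a * impulseResponse g t := by
  simp only [impulseResponse, expansionAtInfinity_C_mul_coeff]
  rw [← tsum_mul_left]
  exact tsum_congr fun k => by ring

theorem feedthrough_add (g h : RatFunc ℝ) :
    feedthrough (g + h) = feedthrough g + feedthrough h := by
  simp [feedthrough, expansionAtInfinity_add]

theorem feedthrough_C_mul (a : ℝ) (g : RatFunc ℝ) :
    feedthrough (RatFunc.C a * g) = a * feedthrough g :=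
  expansionAtInfinity_C_mul_coeff a g 0

/-- The poles of `g` lie in the open left half-plane. -/
def StableEntry (g : RatFunc ℝ) : Prop :=
  ∀ z : ℂ, Polynomial.aeval z g.denom = 0 → z.re < 0

/-- The roots of the denominator have negative real part, so the recurrence makes the impulse
response decay exponentially. -/
theorem StableEntry.integrableOn {g : RatFunc ℝ} (hg : StableEntry g) :
    IntegrableOn (impulseResponse g) (Set.Ioi 0) := by
  obtain ⟨K, ε, hε, h⟩ := exists_norm_expSeries_le_exp_of_recurrence (denom_map_ne_zero g)
    (fun z hz => hg z (by rwa [Polynomial.eval_map_algebraMap] at hz)) (markov_recurrence g)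
  refine Integrable.mono' ((integrableOn_exp_mul_Ioi (neg_neg_of_pos hε) 0).const_mul K)
    (continuous_impulseResponse g).aestronglyMeasurable ?_
  refine (ae_restrict_mem measurableSet_Ioi).mono fun t ht => ?_
  have := h t (le_of_lt ht)
  rwa [expSeries_ofReal, Complex.norm_real, ← impulseResponse_eq_expSeries] at this

theorem StableEntry.of_dvd {g : RatFunc ℝ} {q : Polynomial ℝ} (h : g.denom ∣ q)
    (hq : ∀ z : ℂ, Polynomial.aeval z q = 0 → z.re < 0) : StableEntry g := fun z hz => by
  obtain ⟨r, hr⟩ := h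
  exact hq z (by rw [hr, map_mul, hz, zero_mul])

theorem StableEntry.add {g h : RatFunc ℝ} (hg : StableEntry g) (hh : StableEntry h) :
    StableEntry (g + h) := .of_dvd (RatFunc.denom_add_dvd g h) fun z hz => by
  rw [map_mul, mul_eq_zero] at hz
  exact hz.elim (hg z) (hh z)

theorem StableEntry.mul {g h : RatFunc ℝ} (hg : StableEntry g) (hh : StableEntry h) :
    StableEntry (g * h) := .of_dvd (RatFunc.denom_mul_dvd g h) fun z hz => by
  rw [map_mul, mul_eq_zero] at hz
  exact hz.elim (hg z) (hh z)

theorem stableEntry_C (a : ℝ) : StableEntry (RatFunc.C a) := fun z hz => by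
  simp at hz

theorem stableEntry_sum {ι : Type*} (s : Finset ι) {g : ι → RatFunc ℝ}
    (hg : ∀ i ∈ s, StableEntry (g i)) : StableEntry (∑ i ∈ s, g i) :=
  Finset.sum_induction _ StableEntry (fun _ _ => .add)
    (by simpa using stableEntry_C 0) hg

end Impulse

/-! ### Stable and proper transfer matrices -/

section TransferMatrices

variable {k l q : ℕ}

/-- Every entry has a finite limit at infinity. -/
def IsProper (F : TransferMatrix k l) : Prop := ∀ i j, valInfty (F i j) ≤ 1

theorem isStrictlyProper_iff (F : TransferMatrix k l) :
    IsStrictlyProper F ↔ ∀ i j, valInfty (F i j) < 1 :=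
  forall₂_congr fun i j => (valInfty_lt_one_iff (F i j)).symm

theorem IsStrictlyProper.val_lt {F : TransferMatrix k l} (hF : IsStrictlyProper F) (i : Fin k)
    (j : Fin l) : valInfty (F i j) < 1 := (isStrictlyProper_iff F).1 hF i j

theorem IsStrictlyProper.isProper {F : TransferMatrix k l} (hF : IsStrictlyProper F) :
    IsProper F := fun i j => (hF.val_lt i j).le

theorem isProper_const (M : Matrix (Fin k) (Fin l) ℝ) : IsProper (const M) :=
  fun i j => valInfty_C_le (M i j)

theorem IsProper.add {F G : TransferMatrix k l} (hF : IsProper F) (hG : IsProper G) :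
    IsProper (F + G) := fun i j => valInfty.map_add_le (hF i j) (hG i j)

theorem IsProper.mul {F : TransferMatrix k l} {G : TransferMatrix l q} (hF : IsProper F)
    (hG : IsProper G) : IsProper (F * G) := fun i j => by
  rw [Matrix.mul_apply]
  refine valInfty.map_sum_le fun a _ => ?_
  rw [map_mul]
  exact mul_le_one' (hF i a) (hG a j)

theorem IsStrictlyProper.add {F G : TransferMatrix k l} (hF : IsStrictlyProper F)
    (hG : IsStrictlyProper G) : IsStrictlyProper (F + G) :=
  (isStrictlyProper_iff _).2 fun i j => valInfty.map_add_lt (hF.val_lt i j) (hG.val_lt i j)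

theorem IsStrictlyProper.mul_isProper {F : TransferMatrix k l} {G : TransferMatrix l q}
    (hF : IsStrictlyProper F) (hG : IsProper G) : IsStrictlyProper (F * G) :=
  (isStrictlyProper_iff _).2 fun i j => by
    rw [Matrix.mul_apply]
    refine valInfty.map_sum_lt one_ne_zero fun a _ => ?_
    rw [map_mul]
    exact mul_lt_one_of_lt_of_le (hF.val_lt i a) (hG a j)

theorem IsProper.mul_isStrictlyProper {F : TransferMatrix k l} {G : TransferMatrix l q}
    (hF : IsProper F) (hG : IsStrictlyProper G) : IsStrictlyProper (F * G) :=
  (isStrictlyProper_iff _).2 fun i j => by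
    rw [Matrix.mul_apply]
    refine valInfty.map_sum_lt one_ne_zero fun a _ => ?_
    rw [map_mul, mul_comm]
    exact mul_lt_one_of_lt_of_le (hG.val_lt a j) (hF i a)

theorem isStable_const (M : Matrix (Fin k) (Fin l) ℝ) : IsStable (const M) :=
  fun i j => stableEntry_C (M i j)

theorem IsStable.add {F G : TransferMatrix k l} (hF : IsStable F) (hG : IsStable G) :
    IsStable (F + G) := fun i j => StableEntry.add (hF i j) (hG i j)

theorem IsStable.mul {F : TransferMatrix k l} {G : TransferMatrix l q} (hF : IsStable F)
    (hG : IsStable G) : IsStable (F * G) := fun i j => by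
  rw [Matrix.mul_apply]
  exact stableEntry_sum _ fun a _ => StableEntry.mul (hF i a) (hG a j)

theorem const_one : const (1 : Matrix (Fin k) (Fin k) ℝ) = 1 := by
  simp [const]

theorem C_smul_eq_const_mul (a : ℝ) (F : TransferMatrix k l) :
    RatFunc.C a • F = const (a • (1 : Matrix (Fin k) (Fin k) ℝ)) * F := by
  have : const (a • (1 : Matrix (Fin k) (Fin k) ℝ)) =
      RatFunc.C a • (1 : TransferMatrix k k) := by
    ext i j
    by_cases h : i = j <;> simp [const, h]
  rw [this, Matrix.smul_mul, Matrix.one_mul]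

end TransferMatrices

/-! ### The resolvent -/

section Resolvent

variable {k : ℕ} (A : Matrix (Fin k) (Fin k) ℝ)

theorem X_smul_one_sub_const :
    (RatFunc.X : RatFunc ℝ) • (1 : TransferMatrix k k) - const A =
      (algebraMap (Polynomial ℝ) (RatFunc ℝ)).mapMatrix A.charmatrix := by
  ext i j
  by_cases h : i = j <;> simp [const, Matrix.charmatrix, h]

theorem det_X_smul_one_sub_const :
    ((RatFunc.X : RatFunc ℝ) • (1 : TransferMatrix k k) - const A).det =
      algebraMap (Polynomial ℝ) (RatFunc ℝ) A.charpoly := by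
  rw [X_smul_one_sub_const, ← RingHom.map_det]
  rfl

theorem det_X_smul_one_sub_const_ne_zero :
    ((RatFunc.X : RatFunc ℝ) • (1 : TransferMatrix k k) - const A).det ≠ 0 := by
  rw [det_X_smul_one_sub_const]
  exact RatFunc.algebraMap_ne_zero (Matrix.charpoly_monic A).ne_zero

theorem X_smul_resolvent :
    (RatFunc.X : RatFunc ℝ) • resolvent A = const A * resolvent A + 1 := by
  have h := Matrix.mul_nonsing_inv _ (det_X_smul_one_sub_const_ne_zero A).isUnit
  rw [Matrix.sub_mul, Matrix.smul_mul, Matrix.one_mul] at h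
  rw [← h, resolvent]
  abel

theorem resolvent_apply (i j : Fin k) :
    resolvent A i j = algebraMap (Polynomial ℝ) (RatFunc ℝ) (A.charmatrix.adjugate i j) /
      algebraMap (Polynomial ℝ) (RatFunc ℝ) A.charpoly := by
  rw [resolvent, Matrix.inv_def, det_X_smul_one_sub_const, Ring.inverse_eq_inv',
    X_smul_one_sub_const, ← RingHom.map_adjugate, Matrix.smul_apply, smul_eq_mul,
    inv_mul_eq_div]
  rfl

variable {A}

theorem IsHurwitz.isStable_resolvent (hA : IsHurwitz A) : IsStable (resolvent A) := fun i j => by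
  rw [resolvent_apply]
  refine StableEntry.of_dvd (RatFunc.denom_div_dvd _ _) fun z hz => hA z ?_
  rw [Matrix.mem_spectrum_iff_isRoot_charpoly, Matrix.charpoly_map, Polynomial.IsRoot,
    Polynomial.eval_map_algebraMap]
  exact hz

/-- Suppose an entry of largest valuation had valuation at least 1. The identity `s R = A R + I`
bounds its product with `s` by that same valuation, whereas multiplication by `s` strictly increases
it. -/
theorem isStrictlyProper_resolvent (A : Matrix (Fin k) (Fin k) ℝ) :
    IsStrictlyProper (resolvent A) := by
  rw [isStrictlyProper_iff]
  by_contra! h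
  obtain ⟨i₀, j₀, h₀⟩ := h
  have : Nonempty (Fin k × Fin k) := ⟨(i₀, j₀)⟩
  obtain ⟨⟨i, j⟩, hmax⟩ :=
    Finite.exists_max fun ij : Fin k × Fin k => valInfty (resolvent A ij.1 ij.2)
  have h1 : 1 ≤ valInfty (resolvent A i j) := h₀.trans (hmax (i₀, j₀))
  have hX := congrFun (congrFun (X_smul_resolvent A) i) j
  have hle : valInfty ((const A * resolvent A + 1) i j) ≤ valInfty (resolvent A i j) := by
    refine valInfty.map_add_le ?_ ?_
    · rw [Matrix.mul_apply]
      refine valInfty.map_sum_le fun a _ => ?_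
      rw [map_mul]
      exact (mul_le_of_le_one_left' (isProper_const A i a)).trans (hmax (a, j))
    · have := isProper_const (1 : Matrix (Fin k) (Fin k) ℝ) i j
      rw [const_one] at this
      exact this.trans h1
  rw [← hX, Matrix.smul_apply, smul_eq_mul, map_mul] at hle
  have hval : (1 : WithZero (Multiplicative ℤ)) < valInfty RatFunc.X := by
    rw [valInfty_of_ne_zero RatFunc.X_ne_zero, ← WithZero.exp_zero, WithZero.exp_lt_exp,
      RatFunc.intDegree_X]
    exact one_pos
  have hpos : 0 < valInfty (resolvent A i j) := lt_of_lt_of_le zero_lt_one h1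
  exact absurd hle (not_le.2 ((lt_mul_iff_one_lt_left hpos).2 hval))

end Resolvent

/-! ### The transfer matrices of the design -/

namespace Design

variable {n m p nz mr : ℕ} {S : Design n m p nz mr}

/-- If `Z` were singular, its formal inverse would be 0 and the interactor limit would be 0. Full
rank then forces `m = 0`, but an empty determinant is 1. -/
theorem InteractorConditions.isUnit_det_Z (h : S.InteractorConditions) : IsUnit S.Z.det := by
  by_contra hZ
  obtain ⟨E, hrank, hlim⟩ := h.interactor
  rw [Matrix.nonsing_inv_apply_not_isUnit _ hZ] at hlim
  have hE : E = 0 := by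
    ext i j
    have := hlim i j
    simp only [Matrix.mul_zero, Matrix.zero_apply, RatFunc.eval_zero] at this
    exact_mod_cast (tendsto_nhds_unique this tendsto_const_nhds)
  rw [hE, Matrix.rank_zero] at hrank
  subst hrank
  exact hZ (by simp)

theorem isProper_Z (S : Design n m p nz mr) : IsProper S.Z :=
  (((isProper_const _).mul (isStrictlyProper_resolvent _).isProper).mul (isProper_const _)).add
    (isProper_const _)

theorem isStrictlyProper_H₀ (S : Design n m p nz mr) : IsStrictlyProper S.H₀ :=
  (isStrictlyProper_resolvent _).mul_isProper (isProper_const _)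

theorem X_smul_H₀ (S : Design n m p nz mr) :
    (RatFunc.X : RatFunc ℝ) • S.H₀ = const S.Am * S.H₀ + const S.Bm := by
  rw [H₀, ← Matrix.smul_mul, X_smul_resolvent, Matrix.add_mul, Matrix.one_mul, Matrix.mul_assoc]

theorem X_smul_Hr (S : Design n m p nz mr) (ω : ℝ) :
    (RatFunc.X : RatFunc ℝ) • S.Hr ω = const S.Am * S.Hr ω +
      const S.Bm * (const (ω • (1 : Matrix (Fin m) (Fin m) ℝ)) * (S.C₀ ω * const S.Kg)) := by
  rw [← C_smul_eq_const_mul, ← Matrix.smul_mul, ← C, Hr, ← Matrix.smul_mul, ← Matrix.smul_mul,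
    X_smul_H₀]
  simp only [Matrix.add_mul, Matrix.mul_assoc]

theorem one_sub_eq (F : TransferMatrix m m) :
    1 - F = const 1 + const (-1 : Matrix (Fin m) (Fin m) ℝ) * F := by
  have : const (-1 : Matrix (Fin m) (Fin m) ℝ) = -1 := by
    ext i j
    by_cases h : i = j <;> simp [const, h]
  rw [this, const_one, Matrix.neg_mul, Matrix.one_mul, sub_eq_add_neg]

/-- The feedthrough of `s G` is `B_m`, since `C₀` is strictly proper under the design conditions.
The response of `G` is therefore differentiated only for continuous inputs. -/
theorem X_smul_G (S : Design n m p nz mr) (ω : ℝ) :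
    (RatFunc.X : RatFunc ℝ) • S.G ω = const S.Am * S.G ω +
      const S.Bm * (const 1 + const (-ω • (1 : Matrix (Fin m) (Fin m) ℝ)) * S.C₀ ω) := by
  have h : const (-ω • (1 : Matrix (Fin m) (Fin m) ℝ)) * S.C₀ ω = - S.C ω := by
    rw [← C_smul_eq_const_mul, map_neg, neg_smul, C]
  rw [h, const_one, ← sub_eq_add_neg, G, ← Matrix.smul_mul, X_smul_H₀, Matrix.add_mul,
    Matrix.mul_assoc]

namespace Admissible

variable {ω : ℝ}

theorem ω_pos (hS : S.Admissible) (hω : ω ∈ Set.Icc S.ωl S.ωu) : 0 < ω := hS.plant.ωl_pos.trans_le hω.1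

/-- Write `C = (C Z⁻¹) Z`, a strictly proper factor times a proper one. -/
theorem isStrictlyProper_C (hS : S.Admissible) (hω : ω ∈ Set.Icc S.ωl S.ωu) : IsStrictlyProper (S.C ω) := by
  have h := (hS.filter_strictlyProper ω hω).mul_isProper S.isProper_Z
  rwa [Matrix.mul_assoc, Matrix.nonsing_inv_mul _ hS.interactor.isUnit_det_Z,
    Matrix.mul_one] at h

theorem C₀_eq (hS : S.Admissible) (hω : ω ∈ Set.Icc S.ωl S.ωu) : S.C₀ ω = const (ω⁻¹ • (1 : Matrix (Fin m) (Fin m) ℝ)) * S.C ω := by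
  rw [← C_smul_eq_const_mul, C, smul_smul, ← map_mul, inv_mul_cancel₀ (hS.ω_pos hω).ne', map_one,
    one_smul]

theorem isStrictlyProper_C₀ (hS : S.Admissible) (hω : ω ∈ Set.Icc S.ωl S.ωu) : IsStrictlyProper (S.C₀ ω) := by
  rw [hS.C₀_eq hω]
  exact (isProper_const _).mul_isStrictlyProper (hS.isStrictlyProper_C hω)

theorem isStable_C₀ (hS : S.Admissible) (hω : ω ∈ Set.Icc S.ωl S.ωu) : IsStable (S.C₀ ω) := by
  rw [hS.C₀_eq hω]
  exact (isStable_const _).mul (hS.filter_stable ω hω)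

theorem isStable_H₀ (hS : S.Admissible) : IsStable S.H₀ :=
  hS.plant.Am_hurwitz.isStable_resolvent.mul (isStable_const _)

theorem isStrictlyProper_C₀_mul_Kg (hS : S.Admissible) (hω : ω ∈ Set.Icc S.ωl S.ωu) :
    IsStrictlyProper (S.C₀ ω * const S.Kg) :=
  (hS.isStrictlyProper_C₀ hω).mul_isProper (isProper_const _)

theorem isStable_C₀_mul_Kg (hS : S.Admissible) (hω : ω ∈ Set.Icc S.ωl S.ωu) :
    IsStable (S.C₀ ω * const S.Kg) := (hS.isStable_C₀ hω).mul (isStable_const _)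

theorem isStrictlyProper_Hr (hS : S.Admissible) (hω : ω ∈ Set.Icc S.ωl S.ωu) :
    IsStrictlyProper (S.Hr ω) :=
  (S.isStrictlyProper_H₀.mul_isProper (hS.isStrictlyProper_C hω).isProper).mul_isProper
    (isProper_const _)

theorem isStable_Hr (hS : S.Admissible) (hω : ω ∈ Set.Icc S.ωl S.ωu) : IsStable (S.Hr ω) :=
  (hS.isStable_H₀.mul (hS.filter_stable ω hω)).mul (isStable_const _)

theorem isStrictlyProper_G (hS : S.Admissible) (hω : ω ∈ Set.Icc S.ωl S.ωu) :
    IsStrictlyProper (S.G ω) := by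
  rw [G, one_sub_eq]
  exact S.isStrictlyProper_H₀.mul_isProper
    ((isProper_const _).add ((isProper_const _).mul (hS.isStrictlyProper_C hω).isProper))

theorem isStable_G (hS : S.Admissible) (hω : ω ∈ Set.Icc S.ωl S.ωu) : IsStable (S.G ω) := by
  rw [G, one_sub_eq]
  exact hS.isStable_H₀.mul
    ((isStable_const _).add ((isStable_const _).mul (hS.filter_stable ω hω)))

/-- The strictly proper filter gives `H_r` relative degree at least two. Its response to a merely
essentially bounded `r` is thus differentiable at every time. -/
theorem isStrictlyProper_X_smul_Hr (hS : S.Admissible) (hω : ω ∈ Set.Icc S.ωl S.ωu) :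
    IsStrictlyProper ((RatFunc.X : RatFunc ℝ) • S.Hr ω) := by
  rw [X_smul_Hr]
  exact ((isProper_const _).mul_isStrictlyProper (hS.isStrictlyProper_Hr hω)).add
    ((isProper_const _).mul_isStrictlyProper
      ((isProper_const _).mul_isStrictlyProper (hS.isStrictlyProper_C₀_mul_Kg hω)))

end Admissible

end Design

/-! ### Convolutions with bounded signals -/

section Convolution

/-- A measurable, essentially bounded scalar signal. -/
structure IsBoundedSignal (v : ℝ → ℝ) : Prop where
  aestronglyMeasurable : AEStronglyMeasurable v volume
  bounded : ∃ V, 0 ≤ V ∧ ∀ᵐ s, ‖v s‖ ≤ V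

theorem IsBoundedSignal.mul_intervalIntegrable {v k : ℝ → ℝ} (hv : IsBoundedSignal v)
    (hk : Continuous k) (a b : ℝ) : IntervalIntegrable (fun s => k s * v s) volume a b := by
  obtain ⟨V, -, hV⟩ := hv.bounded
  have hk' := hk.intervalIntegrable (μ := volume) a b
  rw [intervalIntegrable_iff] at hk' ⊢
  exact hk'.mul_bdd (c := V) hv.aestronglyMeasurable.restrict (ae_restrict_of_ae hV)

theorem IsBoundedSignal.hasDerivAt_convolution_fixed {v k k' : ℝ → ℝ} (hv : IsBoundedSignal v)
    (hk : ∀ t, HasDerivAt k (k' t) t) (hk' : Continuous k') (t₀ : ℝ) :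
    HasDerivAt (fun t => ∫ s in (0 : ℝ)..t₀, k (t - s) * v s)
      (∫ s in (0 : ℝ)..t₀, k' (t₀ - s) * v s) t₀ := by
  have hkc : Continuous k := continuous_iff_continuousAt.2 fun t => (hk t).continuousAt
  obtain ⟨V, hV0, hV⟩ := hv.bounded
  obtain ⟨K, hK⟩ := (isCompact_Icc (a := -(|t₀| + 1)) (b := |t₀| + 1)).exists_bound_of_continuousOn
    hk'.continuousOn
  refine (intervalIntegral.hasDerivAt_integral_of_dominated_loc_of_deriv_le
    (F := fun t s => k (t - s) * v s) (F' := fun t s => k' (t - s) * v s)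
    (bound := fun _ => K * V) (Metric.ball_mem_nhds t₀ one_pos) (Eventually.of_forall fun t => ?_)
    ?_ ?_ ?_ intervalIntegrable_const ?_).2
  · exact ((hkc.comp (continuous_sub_left t)).aestronglyMeasurable.mul
      hv.aestronglyMeasurable).restrict
  · exact hv.mul_intervalIntegrable (hkc.comp (continuous_sub_left t₀)) 0 t₀
  · exact ((hk'.comp (continuous_sub_left t₀)).aestronglyMeasurable.mul
      hv.aestronglyMeasurable).restrict
  · filter_upwards [hV] with s hs hs0 t ht
    rw [norm_mul]
    have hts : t - s ∈ Set.Icc (-(|t₀| + 1)) (|t₀| + 1) := by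
      rw [Metric.mem_ball, Real.dist_eq] at ht
      rw [Set.mem_Icc, ← abs_le]
      have h1 : |t₀ - s| ≤ |t₀| := by
        simpa using Set.abs_sub_right_of_mem_uIcc (Set.uIoc_subset_uIcc hs0)
      calc |t - s| = |(t - t₀) + (t₀ - s)| := by ring_nf
        _ ≤ |t - t₀| + |t₀ - s| := abs_add_le _ _
        _ ≤ _ := by linarith
    exact mul_le_mul (hK _ hts) hs (norm_nonneg _) ((norm_nonneg _).trans (hK _ hts))
  · refine Eventually.of_forall fun s _ t _ => ?_
    have h1 := (hk (t - s)).comp_sub_const t s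
    exact h1.mul_const (v s)

/-- Since `k 0 = 0`, the kernel is of size `O(|t - t₀|)` on an interval of length `|t - t₀|`. The
integral is quadratically small, with no continuity of `v` needed. -/
theorem IsBoundedSignal.hasDerivAt_convolution_moving {v k k' : ℝ → ℝ} (hv : IsBoundedSignal v)
    (hk : ∀ t, HasDerivAt k (k' t) t) (hk' : Continuous k') (hk0 : k 0 = 0) (t₀ : ℝ) :
    HasDerivAt (fun t => ∫ s in t₀..t, k (t - s) * v s) 0 t₀ := by
  obtain ⟨V, hV0, hV⟩ := hv.bounded
  obtain ⟨K, hK⟩ := (isCompact_Icc (a := (-1 : ℝ)) (b := 1)).exists_bound_of_continuousOn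
    hk'.continuousOn
  have hlip : ∀ s ∈ Set.Icc (-1 : ℝ) 1, ‖k s‖ ≤ K * |s| := fun s hs => by
    have := (convex_Icc (-1 : ℝ) 1).norm_image_sub_le_of_norm_hasDerivWithin_le
      (fun y _ => (hk y).hasDerivWithinAt) hK (by simp : (0 : ℝ) ∈ Set.Icc (-1 : ℝ) 1) hs
    simpa [hk0] using this
  have hK0 : 0 ≤ K := (norm_nonneg _).trans (hK 0 (by simp))
  have hO : (fun t => ∫ s in t₀..t, k (t - s) * v s) =O[𝓝 t₀] fun t => ‖t - t₀‖ ^ 2 := by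
    refine Asymptotics.IsBigO.of_bound (K * V) ?_
    filter_upwards [Metric.ball_mem_nhds t₀ one_pos] with t ht
    rw [Metric.mem_ball, Real.dist_eq] at ht
    have hb : ∀ᵐ s, s ∈ Set.uIoc t₀ t → ‖k (t - s) * v s‖ ≤ K * |t - t₀| * V := by
      filter_upwards [hV] with s hs hst
      have h1 : |t - s| ≤ |t - t₀| :=
        Set.abs_sub_right_of_mem_uIcc (Set.uIoc_subset_uIcc hst)
      rw [norm_mul]
      have h2 := hlip (t - s) (abs_le.1 (h1.trans ht.le))
      refine mul_le_mul (h2.trans ?_) hs (norm_nonneg _) (by positivity)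
      gcongr
    refine (intervalIntegral.norm_integral_le_of_norm_le_const_ae hb).trans_eq ?_
    simp only [Real.norm_eq_abs, abs_pow, abs_abs]
    ring
  exact (hO.hasFDerivAt one_lt_two).hasDerivAt.congr_deriv (by simp)

theorem IsBoundedSignal.hasDerivAt_convolution {v k k' : ℝ → ℝ} (hv : IsBoundedSignal v)
    (hk : ∀ t, HasDerivAt k (k' t) t) (hk' : Continuous k') (hk0 : k 0 = 0) (t₀ : ℝ) :
    HasDerivAt (fun t => ∫ s in (0 : ℝ)..t, k (t - s) * v s)
      (∫ s in (0 : ℝ)..t₀, k' (t₀ - s) * v s) t₀ := by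
  have hkc : Continuous k := continuous_iff_continuousAt.2 fun t => (hk t).continuousAt
  have h := (hv.hasDerivAt_convolution_fixed hk hk' t₀).add
    (hv.hasDerivAt_convolution_moving hk hk' hk0 t₀)
  rw [add_zero] at h
  refine h.congr_of_eventuallyEq (Eventually.of_forall fun t => ?_)
  have hi := hv.mul_intervalIntegrable (hkc.comp (continuous_sub_left t))
  exact (intervalIntegral.integral_add_adjacent_intervals (hi 0 t₀) (hi t₀ t)).symm

theorem IsBoundedSignal.hasDerivAt_convolution_of_continuous {v k k' : ℝ → ℝ}
    (hv : IsBoundedSignal v) (hvc : Continuous v) (hk : ∀ t, HasDerivAt k (k' t) t)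
    (hk' : Continuous k') (t₀ : ℝ) :
    HasDerivAt (fun t => ∫ s in (0 : ℝ)..t, k (t - s) * v s)
      (k 0 * v t₀ + ∫ s in (0 : ℝ)..t₀, k' (t₀ - s) * v s) t₀ := by
  have hkc : Continuous k := continuous_iff_continuousAt.2 fun t => (hk t).continuousAt
  -- Subtracting `k 0` reduces to a kernel vanishing at 0; the part left over is `k 0 * ∫ v`, where
  -- continuity of `v` enters.
  have h1 := hv.hasDerivAt_convolution (k := fun t => k t - k 0) (fun t => (hk t).sub_const _) hk'
    (sub_self _) t₀
  have h2 := ((hvc.integral_hasStrictDerivAt 0 t₀).hasDerivAt).const_mul (k 0)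
  refine (h2.add h1).congr_of_eventuallyEq (Eventually.of_forall fun t => ?_)
  have hi1 := (hvc.intervalIntegrable (μ := volume) 0 t).const_mul (k 0)
  have hi2 : IntervalIntegrable (fun s => (k (t - s) - k 0) * v s) volume 0 t :=
    hv.mul_intervalIntegrable ((hkc.comp (continuous_sub_left t)).sub continuous_const) 0 t
  simp only [Pi.add_apply]
  rw [← intervalIntegral.integral_const_mul, ← intervalIntegral.integral_add hi1 hi2]
  refine intervalIntegral.integral_congr fun s _ => ?_
  ring

end Convolution

/-! ### The zero-state response -/

section EntryResponse

/-- The zero-state response of a scalar transfer function. -/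
def entryResponse (g : RatFunc ℝ) (v : ℝ → ℝ) (t : ℝ) : ℝ :=
  feedthrough g * v t + ∫ s in (0 : ℝ)..t, impulseResponse g (t - s) * v s

theorem IsBoundedSignal.impulseResponse_mul {v : ℝ → ℝ} (hv : IsBoundedSignal v) (g : RatFunc ℝ)
    (t : ℝ) : IntervalIntegrable (fun s => impulseResponse g (t - s) * v s) volume 0 t :=
  hv.mul_intervalIntegrable ((continuous_impulseResponse g).comp (continuous_sub_left t)) 0 t

theorem IsBoundedSignal.entryResponse_add_left {v : ℝ → ℝ} (hv : IsBoundedSignal v)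
    (g h : RatFunc ℝ) (t : ℝ) :
    entryResponse (g + h) v t = entryResponse g v t + entryResponse h v t := by
  simp only [entryResponse, feedthrough_add, impulseResponse_add, add_mul]
  rw [intervalIntegral.integral_add (hv.impulseResponse_mul g t) (hv.impulseResponse_mul h t)]
  ring

theorem IsBoundedSignal.entryResponse_sum_left {v : ℝ → ℝ} (hv : IsBoundedSignal v) {ι : Type*}
    (s : Finset ι) (g : ι → RatFunc ℝ) (t : ℝ) :
    entryResponse (∑ i ∈ s, g i) v t = ∑ i ∈ s, entryResponse (g i) v t :=
  map_sum (AddMonoidHom.mk' (fun g => entryResponse g v t)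
    fun g h => hv.entryResponse_add_left g h t) g s

theorem entryResponse_C_mul_left (a : ℝ) (g : RatFunc ℝ) (v : ℝ → ℝ) (t : ℝ) :
    entryResponse (RatFunc.C a * g) v t = a * entryResponse g v t := by
  simp only [entryResponse, feedthrough_C_mul, impulseResponse_C_mul, mul_assoc]
  rw [intervalIntegral.integral_const_mul]
  ring

theorem entryResponse_add_right (g : RatFunc ℝ) {v w : ℝ → ℝ} (hv : IsBoundedSignal v)
    (hw : IsBoundedSignal w) (t : ℝ) :
    entryResponse g (fun s => v s + w s) t = entryResponse g v t + entryResponse g w t := by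
  simp only [entryResponse, mul_add]
  rw [intervalIntegral.integral_add (hv.impulseResponse_mul g t) (hw.impulseResponse_mul g t)]
  ring

theorem entryResponse_const_mul_right (g : RatFunc ℝ) (a : ℝ) (v : ℝ → ℝ) (t : ℝ) :
    entryResponse g (fun s => a * v s) t = a * entryResponse g v t := by
  simp only [entryResponse, mul_left_comm _ a]
  rw [intervalIntegral.integral_const_mul]
  ring

theorem isBoundedSignal_zero : IsBoundedSignal fun _ => 0 :=
  ⟨aestronglyMeasurable_const, 0, le_rfl, by simp⟩

theorem IsBoundedSignal.add {v w : ℝ → ℝ} (hv : IsBoundedSignal v) (hw : IsBoundedSignal w) :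
    IsBoundedSignal fun s => v s + w s := by
  obtain ⟨V, hV0, hV⟩ := hv.bounded
  obtain ⟨W, hW0, hW⟩ := hw.bounded
  refine ⟨hv.aestronglyMeasurable.add hw.aestronglyMeasurable, V + W, by positivity, ?_⟩
  filter_upwards [hV, hW] with s h1 h2 using (norm_add_le _ _).trans (add_le_add h1 h2)

theorem IsBoundedSignal.const_mul {v : ℝ → ℝ} (hv : IsBoundedSignal v) (a : ℝ) :
    IsBoundedSignal fun s => a * v s := by
  obtain ⟨V, hV0, hV⟩ := hv.bounded
  refine ⟨hv.aestronglyMeasurable.const_mul a, ‖a‖ * V, by positivity, ?_⟩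
  filter_upwards [hV] with s h1
  rw [norm_mul]
  gcongr

theorem IsBoundedSignal.sum {ι : Type*} (s : Finset ι) {v : ι → ℝ → ℝ}
    (hv : ∀ i ∈ s, IsBoundedSignal (v i)) : IsBoundedSignal fun t => ∑ i ∈ s, v i t := by
  have := Finset.sum_induction v IsBoundedSignal (fun _ _ => .add) isBoundedSignal_zero hv
  convert this using 2
  simp

theorem entryResponse_sum_right (g : RatFunc ℝ) {ι : Type*} (s : Finset ι) {v : ι → ℝ → ℝ}
    (hv : ∀ i, IsBoundedSignal (v i)) (t : ℝ) :
    entryResponse g (fun y => ∑ i ∈ s, v i y) t = ∑ i ∈ s, entryResponse g (v i) t := by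
  classical
  induction s using Finset.induction with
  | empty => simp [entryResponse]
  | insert a s ha ih =>
    simp only [Finset.sum_insert ha]
    rw [entryResponse_add_right g (hv a) (.sum s fun i _ => hv i), ih]

theorem entryResponse_congr (g : RatFunc ℝ) (hg : feedthrough g = 0) {v w : ℝ → ℝ} {t : ℝ}
    (ht : 0 ≤ t) (h : ∀ᵐ s, s ∈ Set.Icc 0 t → v s = w s) :
    entryResponse g v t = entryResponse g w t := by
  rw [entryResponse, entryResponse, hg, zero_mul, zero_mul, zero_add, zero_add]
  refine intervalIntegral.integral_congr_ae (h.mono fun s hs hst => ?_)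
  rw [Set.uIoc_of_le ht] at hst
  rw [hs ⟨hst.1.le, hst.2⟩]

/-- Both alternatives are used: the first for the discontinuous command `r` through `H_r`, the
second for the continuous uncertainty through `G`. -/
theorem IsBoundedSignal.hasDerivAt_entryResponse {v : ℝ → ℝ} (hv : IsBoundedSignal v)
    {g : RatFunc ℝ} (hg : feedthrough g = 0)
    (h : feedthrough (RatFunc.X * g) = 0 ∨ Continuous v) (t : ℝ) :
    HasDerivAt (entryResponse g v) (entryResponse (RatFunc.X * g) v t) t := by
  have hfun : entryResponse g v = fun t => ∫ s in (0 : ℝ)..t, impulseResponse g (t - s) * v s := by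
    ext t
    rw [entryResponse, hg, zero_mul, zero_add]
  rw [hfun, entryResponse]
  rcases h with h | h
  · rw [h, zero_mul, zero_add]
    exact hv.hasDerivAt_convolution (hasDerivAt_impulseResponse g) (continuous_impulseResponse _)
      ((impulseResponse_at_zero g).trans h) t
  · rw [← impulseResponse_at_zero]
    exact hv.hasDerivAt_convolution_of_continuous h (hasDerivAt_impulseResponse g)
      (continuous_impulseResponse _) t

theorem l1NormEntry_nonneg (g : RatFunc ℝ) : 0 ≤ l1NormEntry g :=
  add_nonneg (abs_nonneg _) (integral_nonneg fun _ => abs_nonneg _)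

/-- Young's inequality for an integrable kernel and a bounded input. Without feedthrough the value
`v t` does not enter, so an almost-everywhere bound suffices. -/
theorem abs_entryResponse_le {g : RatFunc ℝ} (hg : feedthrough g = 0) (hs : StableEntry g)
    {v : ℝ → ℝ} {V t : ℝ} (hV : 0 ≤ V) (ht : 0 ≤ t) (hv : ∀ᵐ s, s ∈ Set.Icc 0 t → |v s| ≤ V) :
    |entryResponse g v t| ≤ l1NormEntry g * V := by
  rw [entryResponse, hg, zero_mul, zero_add, l1NormEntry, hg, abs_zero, zero_add]
  have hc : Continuous fun s => |impulseResponse g (t - s)| :=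
    ((continuous_impulseResponse g).comp (continuous_sub_left t)).abs
  calc |∫ s in (0 : ℝ)..t, impulseResponse g (t - s) * v s|
      ≤ ∫ s in (0 : ℝ)..t, |impulseResponse g (t - s)| * V := by
        rw [← Real.norm_eq_abs]
        refine intervalIntegral.norm_integral_le_of_norm_le ht (hv.mono fun s hs hst => ?_)
          ((hc.mul continuous_const).intervalIntegrable 0 t)
        rw [norm_mul]
        exact mul_le_mul_of_nonneg_left (hs ⟨hst.1.le, hst.2⟩) (norm_nonneg _)
    _ = (∫ s in (0 : ℝ)..t, |impulseResponse g s|) * V := by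
        rw [intervalIntegral.integral_mul_const,
          intervalIntegral.integral_comp_sub_left (fun s => |impulseResponse g s|)]
        simp
    _ ≤ (∫ s in Set.Ioi (0 : ℝ), |impulseResponse g s|) * V := by
        refine mul_le_mul_of_nonneg_right ?_ hV
        rw [intervalIntegral.integral_of_le ht]
        exact setIntegral_mono_set hs.integrableOn.abs
          (Eventually.of_forall fun _ => abs_nonneg _) Set.Ioc_subset_Ioi_self.eventuallyLE

end EntryResponse

/-! ### Responses of transfer matrices to vector signals -/

section Response

variable {k l q : ℕ}

/-- A vector signal with measurable, essentially bounded components. -/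
def IsBoundedVec (v : ℝ → Fin l → ℝ) : Prop := ∀ j, IsBoundedSignal fun s => v s j

theorem response_apply (F : TransferMatrix k l) (v : ℝ → Fin l → ℝ) (t : ℝ) (i : Fin k) :
    response F v t i = ∑ j, entryResponse (F i j) (fun s => v s j) t := rfl

theorem IsBoundedVec.response_add_left {v : ℝ → Fin l → ℝ} (hv : IsBoundedVec v)
    (F G : TransferMatrix k l) (t : ℝ) :
    response (F + G) v t = response F v t + response G v t := by
  ext i
  simp only [Pi.add_apply, response_apply, ← Finset.sum_add_distrib]
  exact Finset.sum_congr rfl fun j _ => (hv j).entryResponse_add_left _ _ t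

theorem IsBoundedVec.response_const_mul {v : ℝ → Fin q → ℝ} (hv : IsBoundedVec v)
    (M : Matrix (Fin k) (Fin l) ℝ) (F : TransferMatrix l q) (t : ℝ) :
    response (const M * F) v t = M *ᵥ response F v t := by
  ext i
  simp only [response_apply, Matrix.mulVec, dotProduct, Finset.mul_sum]
  rw [Finset.sum_comm]
  refine Finset.sum_congr rfl fun j _ => ?_
  rw [Matrix.mul_apply, (hv j).entryResponse_sum_left]
  exact Finset.sum_congr rfl fun a _ => entryResponse_C_mul_left _ _ _ t

theorem IsBoundedVec.response_mul_const {v : ℝ → Fin q → ℝ} (hv : IsBoundedVec v)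
    (F : TransferMatrix k l) (M : Matrix (Fin l) (Fin q) ℝ) (t : ℝ) :
    response (F * const M) v t = response F (fun s => M *ᵥ v s) t := by
  ext i
  simp only [response_apply, Matrix.mulVec, dotProduct]
  simp_rw [entryResponse_sum_right _ _ (fun j => (hv j).const_mul _),
    entryResponse_const_mul_right]
  rw [Finset.sum_comm]
  refine Finset.sum_congr rfl fun j _ => ?_
  rw [Matrix.mul_apply, (hv j).entryResponse_sum_left]
  refine Finset.sum_congr rfl fun a _ => ?_
  rw [mul_comm (F i a)]
  exact entryResponse_C_mul_left _ _ _ t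

theorem response_sub_right (F : TransferMatrix k l) {v w : ℝ → Fin l → ℝ} (hv : IsBoundedVec v)
    (hw : IsBoundedVec w) (t : ℝ) :
    response F (fun s => v s - w s) t = response F v t - response F w t := by
  ext i
  simp only [Pi.sub_apply, response_apply, ← Finset.sum_sub_distrib]
  refine Finset.sum_congr rfl fun j _ => ?_
  have h := entryResponse_add_right (F i j) (hv j) ((hw j).const_mul (-1)) t
  rw [entryResponse_const_mul_right] at h
  simpa [sub_eq_add_neg] using h

theorem response_const_one (v : ℝ → Fin k → ℝ) (t : ℝ) :
    response (const (1 : Matrix (Fin k) (Fin k) ℝ)) v t = v t := by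
  have hE : ∀ a, expansionAtInfinity (RatFunc.C a) = HahnSeries.single 0 a :=
    fun a => RatFunc.eval_C _ _
  have hC : ∀ (a : ℝ) (w : ℝ → ℝ), entryResponse (RatFunc.C a) w t = a * w t := fun a w => by
    have hne : ∀ j : ℕ, (j : ℤ) + 1 ≠ 0 := fun j => by omega
    simp [entryResponse, feedthrough, impulseResponse, hE, HahnSeries.coeff_single_of_ne (hne _)]
  ext i
  simp only [response_apply, const, Matrix.map_apply, hC]
  simp [Matrix.one_apply]

theorem IsBoundedVec.mulVec {v : ℝ → Fin l → ℝ} (hv : IsBoundedVec v)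
    (M : Matrix (Fin k) (Fin l) ℝ) : IsBoundedVec fun s => M *ᵥ v s :=
  fun i => IsBoundedSignal.sum Finset.univ fun j _ => (hv j).const_mul (M i j)

theorem IsStrictlyProper.feedthrough_eq_zero {F : TransferMatrix k l} (hF : IsStrictlyProper F)
    (i : Fin k) (j : Fin l) : feedthrough (F i j) = 0 :=
  L1Adaptive.feedthrough_eq_zero (hF.val_lt i j)

theorem IsStrictlyProper.response_congr {F : TransferMatrix k l} (hF : IsStrictlyProper F)
    {v w : ℝ → Fin l → ℝ} {t : ℝ} (ht : 0 ≤ t) (h : ∀ s ∈ Set.Icc 0 t, v s = w s) :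
    response F v t = response F w t := by
  ext i
  simp only [response_apply]
  exact Finset.sum_congr rfl fun j _ => entryResponse_congr _ (hF.feedthrough_eq_zero i j) ht
    (Eventually.of_forall fun s hs => congrFun (h s hs) j)

theorem IsBoundedVec.hasDerivAt_response {v : ℝ → Fin l → ℝ} (hv : IsBoundedVec v)
    {F : TransferMatrix k l} (hF : IsStrictlyProper F)
    (h : IsStrictlyProper ((RatFunc.X : RatFunc ℝ) • F) ∨ Continuous v) (t : ℝ) :
    HasDerivAt (response F v) (response ((RatFunc.X : RatFunc ℝ) • F) v t) t := by
  rw [hasDerivAt_pi]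
  intro i
  refine HasDerivAt.fun_sum fun j _ => (hv j).hasDerivAt_entryResponse
    (hF.feedthrough_eq_zero i j) ?_ t
  exact h.imp (fun h => h.feedthrough_eq_zero i j) fun h => (continuous_apply j).comp h

theorem response_zero {F : TransferMatrix k l} (hF : IsStrictlyProper F) (v : ℝ → Fin l → ℝ) :
    response F v 0 = 0 := by
  ext i
  simp [response, hF.feedthrough_eq_zero]

theorem l1Norm_nonneg (F : TransferMatrix k l) : 0 ≤ l1Norm F :=
  Real.iSup_nonneg fun _ => Finset.sum_nonneg fun _ _ => l1NormEntry_nonneg _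

theorem norm_response_le {F : TransferMatrix k l} (hF : IsStrictlyProper F) (hs : IsStable F)
    {v : ℝ → Fin l → ℝ} {V t : ℝ} (hV : 0 ≤ V) (ht : 0 ≤ t)
    (hv : ∀ᵐ s, s ∈ Set.Icc 0 t → ‖v s‖ ≤ V) : ‖response F v t‖ ≤ l1Norm F * V := by
  refine (pi_norm_le_iff_of_nonneg (mul_nonneg (l1Norm_nonneg F) hV)).2 fun i => ?_
  calc ‖response F v t i‖ ≤ ∑ j, |entryResponse (F i j) (fun s => v s j) t| :=
        Finset.abs_sum_le_sum_abs _ _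
    _ ≤ ∑ j, l1NormEntry (F i j) * V :=
        Finset.sum_le_sum fun j _ => abs_entryResponse_le (hF.feedthrough_eq_zero i j) (hs i j) hV
          ht (hv.mono fun s h hst => (norm_le_pi_norm (v s) j).trans (h hst))
    _ = (∑ j, l1NormEntry (F i j)) * V := by rw [Finset.sum_mul]
    _ ≤ l1Norm F * V := by
        refine mul_le_mul_of_nonneg_right ?_ hV
        exact le_ciSup (f := fun i => ∑ j, l1NormEntry (F i j)) (Set.finite_range _).bddAbove i

end Response

theorem matrixNorm_nonneg {k l : ℕ} (M : Matrix (Fin k) (Fin l) ℝ) : 0 ≤ matrixNorm M :=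
  Real.iSup_nonneg fun _ => Finset.sum_nonneg fun _ _ => abs_nonneg _

/-- The command is constrained only on `[0, ∞)`; cutting it off gives a bounded signal on the whole
line, as the convolution lemmas require. -/
theorem IsBoundedVec.of_memLp_indicator {l : ℕ} {r : ℝ → Fin l → ℝ} {s : Set ℝ}
    (hs : MeasurableSet s) (hr : MemLp r ∞ (volume.restrict s)) :
    IsBoundedVec (s.indicator r) := fun j => by
  have h := (memLp_indicator_iff_restrict hs).2 hr
  refine ⟨(continuous_apply j).comp_aestronglyMeasurable h.1,
    (eLpNormEssSup (s.indicator r) volume).toReal, ENNReal.toReal_nonneg, ?_⟩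
  filter_upwards [ae_le_eLpNormEssSup (f := s.indicator r) (μ := volume)] with t ht
  refine (norm_le_pi_norm (s.indicator r t) j).trans ?_
  rw [← toReal_enorm]
  exact ENNReal.toReal_mono (by simpa using h.2.ne) ht

theorem IsBoundedVec.of_continuous_of_bounded {l : ℕ} {v : ℝ → Fin l → ℝ} (hv : Continuous v)
    {V : ℝ} (hV : ∀ s, ‖v s‖ ≤ V) : IsBoundedVec v := fun j =>
  ⟨((continuous_apply j).comp hv).aestronglyMeasurable, V, (norm_nonneg _).trans (hV 0),
    Eventually.of_forall fun s => (norm_le_pi_norm (v s) j).trans (hV s)⟩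

namespace Design

variable {n m p nz mr : ℕ} {S : Design n m p nz mr} {ω τ : ℝ}

/-! ### The constants of the design -/

theorem κm_nonneg (S : Design n m p nz mr) : 0 ≤ S.κm :=
  Real.iSup_nonneg fun _ => matrixNorm_nonneg _

theorem κx_nonneg (S : Design n m p nz mr) (ω : ℝ) : 0 ≤ S.κx ω :=
  add_nonneg (mul_nonneg (l1Norm_nonneg _) (Real.sqrt_nonneg _))
    (mul_nonneg (l1Norm_nonneg _) (Real.sqrt_nonneg _))

theorem rNorm_nonneg (S : Design n m p nz mr) : 0 ≤ S.rNorm := ENNReal.toReal_nonneg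

namespace Admissible

theorem ρint_nonneg (hS : S.Admissible) (ω : ℝ) : 0 ≤ S.ρint ω :=
  mul_nonneg (add_nonneg S.κm_nonneg (S.κx_nonneg ω)) hS.ρ₀_pos.le

theorem ρext_nonneg (hS : S.Admissible) (ω : ℝ) : 0 ≤ S.ρext ω :=
  add_nonneg (mul_nonneg (l1Norm_nonneg _) S.rNorm_nonneg)
    (mul_nonneg (l1Norm_nonneg _) hS.plant.b₀_pos.le)

theorem d_pos (hS : S.Admissible) : 0 < S.d (S.ρr + S.γbar) :=
  hS.plant.d_pos _ (add_pos hS.ρr_pos hS.γbar_pos)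

theorem L_pos (hS : S.Admissible) : 0 < S.L S.ρr :=
  mul_pos (div_pos (add_pos hS.ρr_pos hS.γbar_pos) hS.ρr_pos) hS.d_pos

theorem d_le_L (hS : S.Admissible) : S.d (S.ρr + S.γbar) ≤ S.L S.ρr := by
  refine le_mul_of_one_le_left hS.d_pos.le ((one_le_div hS.ρr_pos).2 ?_)
  linarith [hS.γbar_pos]

theorem l1_condition_mul (hS : S.Admissible) (hω : ω ∈ Set.Icc S.ωl S.ωu) :
    l1Norm (S.G ω) * S.L S.ρr * S.ρr < S.ρr - S.ρext ω - S.ρint ω := by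
  have h := (lt_div_iff₀ (mul_pos hS.L_pos hS.ρr_pos)).1 (hS.l1_condition ω hω)
  rwa [← mul_assoc] at h

theorem one_sub_pos (hS : S.Admissible) (hω : ω ∈ Set.Icc S.ωl S.ωu) :
    0 < 1 - l1Norm (S.G ω) * S.L S.ρr := by
  have h : l1Norm (S.G ω) * S.L S.ρr * S.ρr < 1 * S.ρr := by
    linarith [hS.l1_condition_mul hω, hS.ρext_nonneg ω, hS.ρint_nonneg ω]
  linarith [lt_of_mul_lt_mul_right h hS.ρr_pos.le]

/-- The `L¹` condition rearranges to `ρ_ext + ρ_int < ρ_r (1 - ‖G‖ L)`; dividing by the last factor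
gives the claim. -/
theorem ρext_div_lt_ρrx (hS : S.Admissible) (hω : ω ∈ Set.Icc S.ωl S.ωu) :
    S.ρext ω / (1 - l1Norm (S.G ω) * S.L S.ρr) < S.ρrx ω := by
  rw [ρrx, lt_sub_iff_add_lt, ← add_div, div_lt_iff₀ (hS.one_sub_pos hω)]
  linarith [hS.l1_condition_mul hω]

theorem ρrx_pos (hS : S.Admissible) (hω : ω ∈ Set.Icc S.ωl S.ωu) : 0 < S.ρrx ω :=
  (div_nonneg (hS.ρext_nonneg ω) (hS.one_sub_pos hω).le).trans_lt (hS.ρext_div_lt_ρrx hω)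

/-! ### The uncertainty -/

theorem norm_f_sub_le (hS : S.Admissible) {δ t : ℝ} (hδ : 0 < δ) (ht : 0 ≤ t) {x y : Fin n → ℝ}
    (hx : ‖x‖ < δ) (hy : ‖y‖ < δ) : ‖S.f y t - S.f x t‖ ≤ S.d δ * ‖y - x‖ := by
  refine (convex_ball (0 : Fin n → ℝ) δ).norm_image_sub_le_of_norm_fderiv_le (𝕜 := ℝ)
    (f := fun z => S.f z t) (fun z hz => ?_) (fun z hz => ?_) ?_ ?_
  · exact (hS.plant.f_space δ hδ z (by simpa using hz) t ht).1
  · exact (hS.plant.f_space δ hδ z (by simpa using hz) t ht).2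
  · simpa using hx
  · simpa using hy

theorem norm_f_le (hS : S.Admissible) {x : Fin n → ℝ} (hx : ‖x‖ ≤ S.ρr) {t : ℝ} (ht : 0 ≤ t) :
    ‖S.f x t‖ ≤ S.L S.ρr * ‖x‖ + S.b₀ := by
  have hδ : 0 < S.ρr + S.γbar := add_pos hS.ρr_pos hS.γbar_pos
  have h := hS.norm_f_sub_le hδ ht (x := 0) (y := x) (by simpa using hδ)
    (by linarith [hS.γbar_pos])
  rw [sub_zero] at h
  have h0 := (hS.plant.f_zero t ht).le
  have hL := mul_le_mul_of_nonneg_right hS.d_le_L (norm_nonneg x)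
  calc ‖S.f x t‖ = ‖(S.f x t - S.f 0 t) + S.f 0 t‖ := by rw [sub_add_cancel]
    _ ≤ _ := (norm_add_le _ _).trans (by linarith)

/-- Continuity in `t` alone is combined with a Lipschitz bound in `x` that is uniform in `t`, by
splitting `f(x(s), s)` at the frozen state `x(t)`. -/
theorem continuousOn_f (hS : S.Admissible) {x : ℝ → Fin n → ℝ}
    (hx : ContinuousOn x (Set.Icc 0 τ)) : ContinuousOn (fun s => S.f (x s) s) (Set.Icc 0 τ) := by
  intro t ht
  set δ := ‖x t‖ + 1
  have hδ : 0 < δ := by positivity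
  have hxt : ‖x t‖ < δ := by simp [δ]
  have h1 : Tendsto (fun s => S.f (x t) s) (𝓝[Set.Icc 0 τ] t) (𝓝 (S.f (x t) t)) :=
    (hS.plant.f_time δ hδ (x t) hxt t ht.1).1.continuousWithinAt.mono Set.Icc_subset_Ici_self
  have hlim : Tendsto (fun s => S.d δ * ‖x s - x t‖) (𝓝[Set.Icc 0 τ] t) (𝓝 0) := by
    have := ((hx t ht).sub (continuousWithinAt_const (b := x t))).norm.const_mul (S.d δ)
    simpa [ContinuousWithinAt] using this
  have hnear : ∀ᶠ s in 𝓝[Set.Icc 0 τ] t, ‖x s‖ < δ := (hx t ht).norm.eventually_lt_const hxt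
  have h2 : Tendsto (fun s => S.f (x s) s - S.f (x t) s) (𝓝[Set.Icc 0 τ] t) (𝓝 0) := by
    refine squeeze_zero_norm' ?_ hlim
    filter_upwards [hnear, self_mem_nhdsWithin] with s hs hsτ
    exact hS.norm_f_sub_le hδ hsτ.1 hxt hs
  simpa [ContinuousWithinAt] using h2.add h1

theorem ae_norm_indicator_r_le (hS : S.Admissible) :
    ∀ᵐ s, ‖(Set.Ici 0).indicator S.r s‖ ≤ S.rNorm := by
  have h : rNorm S = (eLpNormEssSup ((Set.Ici 0).indicator S.r) volume).toReal := by
    rw [rNorm, eLpNorm_exponent_top, eLpNormEssSup_indicator_eq_eLpNormEssSup_restrict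
      measurableSet_Ici]
  have hfin := ((memLp_indicator_iff_restrict measurableSet_Ici).2 hS.r_bounded).2.ne
  rw [eLpNorm_exponent_top] at hfin
  filter_upwards [ae_le_eLpNormEssSup (f := (Set.Ici 0).indicator S.r) (μ := volume)] with s hs
  rw [h, ← toReal_enorm]
  exact ENNReal.toReal_mono hfin hs

end Admissible

/-! ### The reference system -/

namespace IsReferenceSolution

variable {x : ℝ → Fin n → ℝ} {u : ℝ → Fin m → ℝ}

theorem continuousOn (h : S.IsReferenceSolution ω τ x u) : ContinuousOn x (Set.Icc 0 τ) :=
  fun t ht => (h.ode t ht).continuousWithinAt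

/-- The uncertainty along a solution on `[0, τ]` extends to a bounded continuous signal. -/
theorem exists_extension (h : S.IsReferenceSolution ω τ x u) (hS : S.Admissible) (hτ : 0 < τ) :
    ∃ η : ℝ → Fin m → ℝ, Continuous η ∧ IsBoundedVec η ∧
      ∀ t ∈ Set.Icc 0 τ, η t = S.f (x t) t := by
  have hc := hS.continuousOn_f h.continuousOn
  -- The extension is constant on each side of `[0, τ]`, which preserves both continuity and the
  -- bound.
  refine ⟨Set.IccExtend hτ.le ((Set.Icc 0 τ).domRestrict fun s => S.f (x s) s),
    hc.domRestrict.Icc_extend', ?_, fun t ht => Set.IccExtend_of_mem hτ.le _ ht⟩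
  obtain ⟨V, hV⟩ := isCompact_Icc.exists_bound_of_continuousOn hc
  exact .of_continuous_of_bounded hc.domRestrict.Icc_extend'
    fun s => hV _ (Set.projIcc 0 τ hτ.le s).2

theorem control_eq (h : S.IsReferenceSolution ω τ x u) (hS : S.Admissible)
    (hω : ω ∈ Set.Icc S.ωl S.ωu) {η : ℝ → Fin m → ℝ} (hη : IsBoundedVec η)
    (hηx : ∀ t ∈ Set.Icc 0 τ, η t = S.f (x t) t) {t : ℝ} (ht : t ∈ Set.Icc 0 τ) :
    u t = response (S.C₀ ω * const S.Kg) ((Set.Ici 0).indicator S.r) t -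
      response (S.C₀ ω) η t := by
  have hr := IsBoundedVec.of_memLp_indicator measurableSet_Ici hS.r_bounded
  rw [h.control t ht, hr.response_mul_const, ← response_sub_right _ (hr.mulVec _) hη]
  refine (hS.isStrictlyProper_C₀ hω).response_congr ht.1 fun s hs => ?_
  rw [hηx s ⟨hs.1, hs.2.trans ht.2⟩, Set.indicator_of_mem (Set.mem_Ici.2 hs.1)]

/-- The right-hand side vanishes at 0 and, by the formulas for `s H_r` and `s G`, satisfies the
differential equation of `x` with the same `u` and `f(x, ·)`. -/
theorem state_eq (h : S.IsReferenceSolution ω τ x u) (hS : S.Admissible)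
    (hω : ω ∈ Set.Icc S.ωl S.ωu) {η : ℝ → Fin m → ℝ} (hηc : Continuous η) (hη : IsBoundedVec η)
    (hηx : ∀ t ∈ Set.Icc 0 τ, η t = S.f (x t) t) {t : ℝ} (ht : t ∈ Set.Icc 0 τ) :
    x t = response (S.Hr ω) ((Set.Ici 0).indicator S.r) t + response (S.G ω) η t := by
  have hr := IsBoundedVec.of_memLp_indicator measurableSet_Ici hS.r_bounded
  set r := (Set.Ici 0).indicator S.r
  have hy : ∀ s ∈ Set.Icc 0 τ, HasDerivAt (fun s => response (S.Hr ω) r s + response (S.G ω) η s)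
      (S.Am *ᵥ (response (S.Hr ω) r s + response (S.G ω) η s) +
        S.Bm *ᵥ (ω • u s + S.f (x s) s)) s := fun s hs => by
    refine ((hr.hasDerivAt_response (hS.isStrictlyProper_Hr hω)
      (Or.inl (hS.isStrictlyProper_X_smul_Hr hω)) s).add
      (hη.hasDerivAt_response (hS.isStrictlyProper_G hω) (Or.inr hηc) s)).congr_deriv ?_
    have hu : u s = response (S.C₀ ω * const S.Kg) r s - response (S.C₀ ω) η s :=
      h.control_eq hS hω hη hηx hs
    rw [X_smul_Hr, X_smul_G, hr.response_add_left, hη.response_add_left, hu, ← hηx s hs]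
    simp only [hr.response_const_mul, hη.response_const_mul, hη.response_add_left,
      response_const_one, Matrix.mulVec_add, Matrix.smul_mulVec, Matrix.one_mulVec, smul_sub,
      neg_smul, Matrix.neg_mulVec, Matrix.mulVec_sub, Matrix.mulVec_neg]
    abel
  have hlip : ∀ s : ℝ, LipschitzWith ‖(Matrix.mulVecLin S.Am).toContinuousLinearMap‖₊
      fun z => S.Am *ᵥ z + S.Bm *ᵥ (ω • u s + S.f (x s) s) := fun s => by
    have h1 := (Matrix.mulVecLin S.Am).toContinuousLinearMap.lipschitz
    refine LipschitzWith.of_dist_le_mul fun z w => ?_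
    rw [dist_add_right]
    exact h1.dist_le_mul z w
  -- The terms `u` and `f(x, ·)` are treated as a given forcing along the solution, so the field is
  -- affine in `z` and globally Lipschitz although `f` need not be.
  refine ODE_solution_unique (v := fun s z => S.Am *ᵥ z + S.Bm *ᵥ (ω • u s + S.f (x s) s)) hlip
    h.continuousOn (fun s hs => ?_) (fun s hs => (hy s hs).continuousAt.continuousWithinAt)
    (fun s hs => (hy s (Set.Ico_subset_Icc_self hs)).hasDerivWithinAt) ?_ ht
  · exact (h.ode s (Set.Ico_subset_Icc_self hs)).mono_of_mem_nhdsWithin (Icc_mem_nhdsGE_of_mem hs)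
  · simp only [h.init, response_zero (hS.isStrictlyProper_Hr hω),
      response_zero (hS.isStrictlyProper_G hω), add_zero]

/-- Only times strictly before `t` are constrained, so the estimate applies at a first hitting time
and also bounds a maximum by itself. -/
theorem norm_state_le_of_forall_lt (h : S.IsReferenceSolution ω τ x u) (hS : S.Admissible)
    (hω : ω ∈ Set.Icc S.ωl S.ωu) (hτ : 0 < τ) {t R : ℝ} (ht : t ∈ Set.Icc 0 τ) (hR0 : 0 ≤ R)
    (hR : R ≤ S.ρr) (hx : ∀ s ∈ Set.Ico 0 t, ‖x s‖ ≤ R) :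
    ‖x t‖ ≤ S.ρext ω + l1Norm (S.G ω) * S.L S.ρr * R := by
  obtain ⟨η, hηc, hη, hηx⟩ := h.exists_extension hS hτ
  have hL := hS.L_pos.le
  have hb := hS.plant.b₀_pos.le
  rw [h.state_eq hS hω hηc hη hηx ht]
  have h1 := norm_response_le (hS.isStrictlyProper_Hr hω) (hS.isStable_Hr hω)
    (v := (Set.Ici 0).indicator S.r) S.rNorm_nonneg ht.1
    (hS.ae_norm_indicator_r_le.mono fun s hs _ => hs)
  have h2 := norm_response_le (hS.isStrictlyProper_G hω) (hS.isStable_G hω) (v := η)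
    (V := S.L S.ρr * R + S.b₀) (by positivity) ht.1 (by
      -- The endpoint `s = t`, where no bound is assumed, is a null set.
      filter_upwards [Measure.ae_ne volume t] with s hst hs
      have hxs := hx s ⟨hs.1, lt_of_le_of_ne hs.2 hst⟩
      rw [hηx s ⟨hs.1, hs.2.trans ht.2⟩]
      refine (hS.norm_f_le (hxs.trans hR) hs.1).trans ?_
      gcongr)
  refine (norm_add_le _ _).trans ((add_le_add h1 h2).trans_eq ?_)
  rw [ρext]
  ring

theorem norm_state_lt (h : S.IsReferenceSolution ω τ x u) (hS : S.Admissible)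
    (hω : ω ∈ Set.Icc S.ωl S.ωu) (hτ : 0 < τ) : ∀ t ∈ Set.Icc 0 τ, ‖x t‖ < S.ρr := by
  by_contra! hcon
  have hcl : IsClosed (Set.Icc 0 τ ∩ (fun t => ‖x t‖) ⁻¹' Set.Ici S.ρr) :=
    h.continuousOn.norm.preimage_isClosed_of_isClosed isClosed_Icc isClosed_Ici
  -- This `t` is the first time with `‖x t‖ ≥ ρ_r`; the estimate from the strict past then gives `‖x
  -- t‖ < ρ_r`.
  obtain ⟨t, ⟨ht, hρ⟩, hmin⟩ := (isCompact_Icc.of_isClosed_subset hcl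
    Set.inter_subset_left).exists_isLeast hcon
  have hlt : ∀ s ∈ Set.Ico 0 t, ‖x s‖ ≤ S.ρr := fun s hs => by
    by_contra! hs'
    exact absurd (hmin ⟨⟨hs.1, hs.2.le.trans ht.2⟩, hs'.le⟩) (not_le.2 hs.2)
  have := h.norm_state_le_of_forall_lt hS hω hτ ht hS.ρr_pos.le le_rfl hlt
  rw [Set.mem_preimage, Set.mem_Ici] at hρ
  linarith [hS.l1_condition_mul hω, hS.ρint_nonneg ω]

theorem norm_state_le (h : S.IsReferenceSolution ω τ x u) (hS : S.Admissible)
    (hω : ω ∈ Set.Icc S.ωl S.ωu) (hτ : 0 < τ) : ∀ t ∈ Set.Icc 0 τ, ‖x t‖ ≤ S.ρrx ω := by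
  obtain ⟨t₀, ht₀, hmax⟩ := isCompact_Icc.exists_isMaxOn (Set.nonempty_Icc.2 hτ.le)
    h.continuousOn.norm
  -- With `R = ‖x t₀‖` at a maximum point, the estimate becomes an inequality for the maximum
  -- itself, solvable because `1 - ‖G‖ L > 0`.
  have h1 := h.norm_state_le_of_forall_lt hS hω hτ ht₀ (norm_nonneg _)
    (h.norm_state_lt hS hω hτ t₀ ht₀).le fun s hs => hmax ⟨hs.1, hs.2.le.trans ht₀.2⟩
  have h2 : ‖x t₀‖ ≤ S.ρext ω / (1 - l1Norm (S.G ω) * S.L S.ρr) := by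
    rw [le_div_iff₀ (hS.one_sub_pos hω)]
    linarith
  exact fun t ht => (hmax ht).trans (h2.trans (hS.ρext_div_lt_ρrx hω).le)

theorem norm_control_le (h : S.IsReferenceSolution ω τ x u) (hS : S.Admissible)
    (hω : ω ∈ Set.Icc S.ωl S.ωu) (hτ : 0 < τ) : ∀ t ∈ Set.Icc 0 τ, ‖u t‖ ≤ S.ρru ω := by
  intro t ht
  obtain ⟨η, -, hη, hηx⟩ := h.exists_extension hS hτ
  have hL := hS.L_pos.le
  have hb := hS.plant.b₀_pos.le
  have hρ := (hS.ρrx_pos hω).le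
  rw [h.control_eq hS hω hη hηx ht]
  have h1 := norm_response_le (hS.isStrictlyProper_C₀_mul_Kg hω) (hS.isStable_C₀_mul_Kg hω)
    (v := (Set.Ici 0).indicator S.r) S.rNorm_nonneg ht.1
    (hS.ae_norm_indicator_r_le.mono fun s hs _ => hs)
  have h2 := norm_response_le (hS.isStrictlyProper_C₀ hω) (hS.isStable_C₀ hω) (v := η)
    (V := S.L S.ρr * S.ρrx ω + S.b₀) (by positivity) ht.1 (Eventually.of_forall fun s hs => by
      have hs' : s ∈ Set.Icc 0 τ := ⟨hs.1, hs.2.trans ht.2⟩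
      have hxs := h.norm_state_le hS hω hτ s hs'
      rw [hηx s hs']
      refine (hS.norm_f_le (h.norm_state_lt hS hω hτ s hs').le hs.1).trans ?_
      gcongr)
  refine (norm_sub_le _ _).trans ((add_le_add h1 h2).trans_eq ?_)
  rw [ρru, add_comm]

end IsReferenceSolution

end Design

theorem truncNorm_le_ofReal {k : ℕ} {τ c : ℝ} {x : ℝ → Fin k → ℝ}
    (h : ∀ t ∈ Set.Icc 0 τ, ‖x t‖ ≤ c) : truncNorm τ x ≤ ENNReal.ofReal c := by
  rw [truncNorm, eLpNorm_exponent_top]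
  exact eLpNormEssSup_le_of_ae_bound ((ae_restrict_mem measurableSet_Icc).mono h)

end L1Adaptive

end

theorem lemma4 {n m p nz mr : ℕ} (S : L1Adaptive.Design n m p nz mr) (hS : S.Admissible)
    (ω : ℝ) (hω : ω ∈ Set.Icc S.ωl S.ωu) :
    0 < S.ρrx ω ∧
      ∀ τ : ℝ, 0 < τ → ∀ (x : ℝ → Fin n → ℝ) (u : ℝ → Fin m → ℝ),
        S.IsReferenceSolution ω τ x u →
          L1Adaptive.truncNorm τ x ≤ ENNReal.ofReal (S.ρrx ω) ∧
            L1Adaptive.truncNorm τ u ≤ ENNReal.ofReal (S.ρru ω) :=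
  ⟨hS.ρrx_pos hω, fun _ hτ _ _ h =>
    ⟨L1Adaptive.truncNorm_le_ofReal (h.norm_state_le hS hω hτ),
      L1Adaptive.truncNorm_le_ofReal (h.norm_control_le hS hω hτ)⟩⟩
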